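/- Let $n \ge 0$ be an integer and let $k \in \{1,2\}$. The (unordered) configuration space of $n$ points in $\mathbb{C}$ is the space of all $n$-tuples of pairwise distinct points of $\mathbb{C}$ (a subspace of $\mathbb{C}^n$) modulo permutations of the coordinates, with the quotient topology; its elements are identified with the $n$-element subsets $P \subset \mathbb{C}$. For $A \subseteq P$, let $\mathrm{int}(A)$ be the set of points of $P$ that lie in the topological interior of the convex hull of $A$, and call $A$ convex if $\mathrm{int}(A) \cap A = \emptyset$. Say that $P$ satisfies the weak Property $\Delta_k$ if 1. at most one three-element subset of $P$ is collinear, and 2. for every convex subset $A \subseteq P$ with $|A| \ge 3$, the set $\mathrm{int}(A)$ has at most $(|A|-3)+k$ elements. Then the set of all configurations $P$ that satisfy the weak Property $\Delta_k$ is a (nonempty) connected subspace of the configuration space of $n$ points in $\mathbb{C}$. -/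

import Mathlib

/-- Ordered configurations: `n`-tuples of pairwise distinct points of `ℂ`, with the subspace
topology from `ℂⁿ`. -/
abbrev OrdConf (n : ℕ) : Type := {x : Fin n → ℂ // Function.Injective x}

/-- Two ordered configurations are identified when they differ by a permutation of the
coordinates. -/
instance permSetoid (n : ℕ) : Setoid (OrdConf n) where
  r x y := ∃ σ : Equiv.Perm (Fin n), y.1 = x.1 ∘ σ
  iseqv :=
    { refl := fun _ => ⟨1, rfl⟩
      symm := by
        rintro x y ⟨σ, h⟩
        exact ⟨σ⁻¹, by rw [h]; ext i; simp⟩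
      trans := by
        rintro x y z ⟨σ, h⟩ ⟨τ, h'⟩
        exact ⟨σ * τ, by rw [h', h]; ext i; simp⟩ }

/-- The unordered configuration space of `n` points in `ℂ`, with the quotient topology. -/
abbrev UConf (n : ℕ) : Type := Quotient (permSetoid n)

/-- The set of `n` points of an unordered configuration. -/
noncomputable def UConf.points {n : ℕ} : UConf n → Finset ℂ :=
  Quotient.lift (fun x : OrdConf n => Finset.univ.image x.1) (by
    rintro x y ⟨σ, h⟩
    ext z
    simp only [Finset.mem_image, Finset.mem_univ, true_and, h, Function.comp_apply]
    exact ⟨fun ⟨i, hi⟩ => ⟨σ⁻¹ i, by simpa using hi⟩, fun ⟨i, hi⟩ => ⟨σ i, hi⟩⟩)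

open Classical in
/-- `int(A)`: the points of `P` in the topological interior of the convex hull of `A`. -/
noncomputable def intPoints (P A : Finset ℂ) : Finset ℂ :=
  P.filter (fun z => z ∈ interior (convexHull ℝ (A : Set ℂ)))

/-- `A ⊆ P` is convex if no point of `A` lies in `int(A)`. -/
def IsConvexSubset (P A : Finset ℂ) : Prop :=
  A ⊆ P ∧ Disjoint (intPoints P A) A

open Classical in
/-- The three-element subsets of `P` that lie on a line. -/
noncomputable def collinearTriples (P : Finset ℂ) : Finset (Finset ℂ) :=
  (P.powersetCard 3).filter (fun T => Collinear ℝ (T : Set ℂ))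

/-- The weak Property `Δ_k`: at most one collinear triple, and `int(A)` has at most
`(|A| - 3) + k` points for every convex subset `A`. For `|A| ≤ 2` the interior is empty and
the bound (which can then be negative) is not imposed. -/
def WeakDelta (k : ℕ) (P : Finset ℂ) : Prop :=
  (collinearTriples P).card ≤ 1 ∧
    ∀ A : Finset ℂ, IsConvexSubset P A → 3 ≤ A.card →
      (intPoints P A).card ≤ (A.card - 3) + k

open scoped Topology
open Filter

/-! The idea is to push interior points out across hull edges, one at a time, without leaving the
weak property, until the configuration is in convex position; configurations in convex position are
then easily joined to each other.

For injective families the weak property becomes `UniqueCol` together with `Bdd` (`weakDelta_iff`).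
A family with a collinear triple is first made generic by moving the middle point of the triple off
its line (`exists_perturb`). This could fail only on a side where some set attains its bound. If
both sides had such a set, the union of the two would violate the bound (`not_tight_both`).

For a generic family with nonempty core, `exists_sees` finds a hull edge `a b` and a core point `p`
inside the triangle `a b e` for every other core point `e`. Otherwise each hull edge would lie
beyond an edge of the hull of the core. Choosing one non-core point for each core point
(`exists_last_beyond`) would then give at most as many points as the core has, with the whole core
inside their hull, contradicting the bound when `k ≤ 2`.

The point `p` is pushed straight through a generic point of the edge `a b`. Up to the edge the bound
survives by exchanging generators (`Sees.bdd_update`). Just past the edge no new interior point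
appears. Genericity of the target keeps at most one collinear triple at each time. The core shrinks
(`exists_move`), so induction reaches convex position.

Finally, points in convex position are translated and moved radially to the unit circle
(`convexPos_radial`). Distinct points on the circle, listed by angle, are parametrized by a convex
set. Unordered configurations make the labelling irrelevant. -/

namespace PlanarConf

/-! ### Orientation determinants and linear functionals on the plane. -/

/-- Twice the signed area of the triangle `a b c`. -/
def cr (a b c : ℂ) : ℝ := (b.re - a.re) * (c.im - a.im) - (b.im - a.im) * (c.re - a.re)

/-- The real inner product on `ℂ`, as a linear functional of the second variable. -/
def lin (w z : ℂ) : ℝ := w.re * z.re + w.im * z.im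

lemma cr_rotate (a b c : ℂ) : cr a b c = cr b c a := by unfold cr; ring

lemma cr_swap (a b c : ℂ) : cr b a c = -cr a b c := by unfold cr; ring

lemma cr_swap_right (a b c : ℂ) : cr a c b = -cr a b c := by unfold cr; ring

lemma cr_self_left (a b : ℂ) : cr a b a = 0 := by unfold cr; ring

lemma cr_self_right (a b : ℂ) : cr a b b = 0 := by unfold cr; ring

/-- The normal vector of the line `a b`. -/
def nrm (a b : ℂ) : ℂ := ⟨-(b.im - a.im), b.re - a.re⟩

lemma cr_eq_lin (a b z : ℂ) : cr a b z = lin (nrm a b) z - lin (nrm a b) a := by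
  simp only [cr, lin, nrm]; ring

lemma nrm_ne_zero {a b : ℂ} (h : a ≠ b) : nrm a b ≠ 0 := by
  intro h0
  apply h
  have h1 := congrArg Complex.re h0
  have h2 := congrArg Complex.im h0
  simp only [nrm, Complex.zero_re, Complex.zero_im] at h1 h2
  apply Complex.ext <;> linarith

lemma lin_add (w x y : ℂ) : lin w (x + y) = lin w x + lin w y := by
  simp only [lin, Complex.add_re, Complex.add_im]; ring

lemma lin_smul (w : ℂ) (t : ℝ) (x : ℂ) : lin w (t • x) = t * lin w x := by
  simp only [lin, Complex.real_smul, Complex.mul_re, Complex.mul_im, Complex.ofReal_re,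
    Complex.ofReal_im]
  ring

lemma lin_neg_left (w x : ℂ) : lin (-w) x = -lin w x := by
  simp only [lin, Complex.neg_re, Complex.neg_im]; ring

lemma lin_self_pos {w : ℂ} (h : w ≠ 0) : 0 < lin w w := by
  have : lin w w = Complex.normSq w := by simp [lin, Complex.normSq_apply]
  rw [this]
  exact Complex.normSq_pos.mpr h

lemma continuous_lin (w : ℂ) : Continuous (lin w) := by
  unfold lin; fun_prop

lemma continuous_cr {X : Type*} [TopologicalSpace X] {a b c : X → ℂ} (ha : Continuous a)
    (hb : Continuous b) (hc : Continuous c) : Continuous fun x => cr (a x) (b x) (c x) := by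
  unfold cr; fun_prop

/-- `lin w` as a linear map. -/
def linMap (w : ℂ) : ℂ →ₗ[ℝ] ℝ where
  toFun := lin w
  map_add' := lin_add w
  map_smul' := fun t x => lin_smul w t x

lemma exists_lin (g : ℂ →ₗ[ℝ] ℝ) : ∃ w, ∀ z, g z = lin w z := by
  refine ⟨⟨g 1, g Complex.I⟩, fun z => ?_⟩
  have : z = z.re • (1 : ℂ) + z.im • Complex.I := by
    apply Complex.ext <;> simp
  conv_lhs => rw [this]
  rw [map_add, map_smul, map_smul]
  simp only [lin, smul_eq_mul]
  ring

/-! ### Convex hulls of finite planar families: separation, boundary points, angular order. -/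

section Hull

variable {ι : Type*}

/-- The convex hull of the points of the family `f` with index in `A`. -/
def hull (f : ι → ℂ) (A : Finset ι) : Set ℂ := convexHull ℝ (f '' (A : Set ι))

lemma hull_mono (f : ι → ℂ) {A B : Finset ι} (h : A ⊆ B) : hull f A ⊆ hull f B :=
  convexHull_mono (Set.image_mono (by exact_mod_cast h))

lemma mem_hull (f : ι → ℂ) {A : Finset ι} {j : ι} (h : j ∈ A) : f j ∈ hull f A :=
  subset_convexHull ℝ _ ⟨j, by exact_mod_cast h, rfl⟩

lemma convex_hull (f : ι → ℂ) (A : Finset ι) : Convex ℝ (hull f A) := convex_convexHull ℝ _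

lemma hull_subset {f : ι → ℂ} {A : Finset ι} {s : Set ℂ} (hs : Convex ℝ s)
    (h : ∀ j ∈ A, f j ∈ s) : hull f A ⊆ s := by
  apply convexHull_min _ hs
  rintro _ ⟨j, hj, rfl⟩
  exact h j (by exact_mod_cast hj)

lemma hull_congr {f g : ι → ℂ} {A : Finset ι} (h : ∀ j ∈ A, f j = g j) : hull f A = hull g A := by
  unfold hull
  congr 1
  exact Set.image_congr (fun j hj => h j (by exact_mod_cast hj))

lemma isClosed_hull (f : ι → ℂ) (A : Finset ι) : IsClosed (hull f A) :=
  ((A.finite_toSet.image f).isCompact_convexHull (𝕜 := ℝ)).isClosed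

lemma lin_le_of_mem_hull {f : ι → ℂ} {A : Finset ι} {w z : ℂ} {c : ℝ}
    (h : ∀ j ∈ A, lin w (f j) ≤ c) (hz : z ∈ hull f A) : lin w z ≤ c :=
  hull_subset (s := {z | lin w z ≤ c}) (convex_halfSpace_le (linMap w).isLinear c) h hz

lemma lin_lt_of_mem_hull {f : ι → ℂ} {A : Finset ι} {w z : ℂ} {c : ℝ}
    (h : ∀ j ∈ A, lin w (f j) < c) (hz : z ∈ hull f A) : lin w z < c :=
  hull_subset (s := {z | lin w z < c}) (convex_halfSpace_lt (linMap w).isLinear c) h hz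

/-- An interior point can be pushed a little in the direction `w` without leaving the hull, which
strictly increases `lin w`. -/
lemma lin_lt_of_mem_interior {f : ι → ℂ} {A : Finset ι} {w z : ℂ} {c : ℝ} (hw : w ≠ 0)
    (h : ∀ j ∈ A, lin w (f j) ≤ c) (hz : z ∈ interior (hull f A)) : lin w z < c := by
  have hcont : Continuous fun t : ℝ => z + t • w := by fun_prop
  have h0 : ∀ᶠ t : ℝ in 𝓝 0, z + t • w ∈ interior (hull f A) := by
    apply hcont.continuousAt.eventually_mem
    simpa using isOpen_interior.mem_nhds hz
  have h1 : ∀ᶠ t : ℝ in 𝓝[>] 0, z + t • w ∈ interior (hull f A) := h0.filter_mono nhdsWithin_le_nhds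
  obtain ⟨t, ht, ht0⟩ := (h1.and self_mem_nhdsWithin).exists
  have h2 := lin_le_of_mem_hull h (interior_subset ht)
  rw [lin_add, lin_smul] at h2
  have h3 : 0 < t * lin w w := mul_pos ht0 (lin_self_pos hw)
  linarith

lemma cr_nonneg_of_mem_hull {f : ι → ℂ} {A : Finset ι} {a b z : ℂ}
    (h : ∀ j ∈ A, 0 ≤ cr a b (f j)) (hz : z ∈ hull f A) : 0 ≤ cr a b z := by
  rw [cr_eq_lin]
  have := lin_le_of_mem_hull (w := -nrm a b) (c := -lin (nrm a b) a) (z := z) (f := f) (A := A)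
    (fun j hj => by
      have := h j hj
      rw [cr_eq_lin] at this
      rw [lin_neg_left]; linarith) hz
  rw [lin_neg_left] at this
  linarith

lemma cr_pos_of_mem_hull {f : ι → ℂ} {A : Finset ι} {a b z : ℂ}
    (h : ∀ j ∈ A, 0 < cr a b (f j)) (hz : z ∈ hull f A) : 0 < cr a b z := by
  rw [cr_eq_lin]
  have := lin_lt_of_mem_hull (w := -nrm a b) (c := -lin (nrm a b) a) (z := z) (f := f) (A := A)
    (fun j hj => by
      have := h j hj
      rw [cr_eq_lin] at this
      rw [lin_neg_left]; linarith) hz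
  rw [lin_neg_left] at this
  linarith

lemma cr_pos_of_mem_interior {f : ι → ℂ} {A : Finset ι} {a b z : ℂ} (hab : a ≠ b)
    (h : ∀ j ∈ A, 0 ≤ cr a b (f j)) (hz : z ∈ interior (hull f A)) : 0 < cr a b z := by
  rw [cr_eq_lin]
  have := lin_lt_of_mem_interior (w := -nrm a b) (c := -lin (nrm a b) a) (z := z) (f := f) (A := A)
    (neg_ne_zero.mpr (nrm_ne_zero hab)) (fun j hj => by
      have := h j hj
      rw [cr_eq_lin] at this
      rw [lin_neg_left]; linarith) hz
  rw [lin_neg_left] at this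
  linarith

/-- Strict separation of a point from a finite hull. -/
lemma exists_lin_lt {f : ι → ℂ} {A : Finset ι} {z : ℂ} (hz : z ∉ hull f A) :
    ∃ w, ∀ j ∈ A, lin w (f j) < lin w z := by
  obtain ⟨g, u, h1, h2⟩ := geometric_hahn_banach_closed_point (convex_hull f A)
    (isClosed_hull f A) hz
  obtain ⟨w, hw⟩ := exists_lin g.toLinearMap
  refine ⟨w, fun j hj => ?_⟩
  have := h1 _ (mem_hull f hj)
  rw [← hw, ← hw]
  exact this.trans h2

/-- Weak separation of a point from the interior of a finite hull. -/
lemma exists_lin_le {f : ι → ℂ} {A : Finset ι} {z : ℂ} (hz : z ∉ interior (hull f A)) :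
    ∃ w, w ≠ 0 ∧ ∀ j ∈ A, lin w (f j) ≤ lin w z := by
  by_cases hne : (interior (hull f A)).Nonempty
  · obtain ⟨g, h1⟩ := geometric_hahn_banach_open_point (convex_hull f A).interior
      isOpen_interior hz
    obtain ⟨w, hw⟩ := exists_lin g.toLinearMap
    have hw' : ∀ z, g z = lin w z := hw
    refine ⟨w, ?_, fun j hj => ?_⟩
    · rintro rfl
      obtain ⟨y, hy⟩ := hne
      have := h1 y hy
      simp [hw', lin] at this
    · have hcl : f j ∈ closure (interior (hull f A)) := by
        rw [(convex_hull f A).closure_interior_eq_closure_of_nonempty_interior hne]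
        exact subset_closure (mem_hull f hj)
      have : closure (interior (hull f A)) ⊆ {y | lin w y ≤ lin w z} :=
        closure_minimal (fun y hy => by
          have := h1 y hy
          rw [hw', hw'] at this
          exact this.le) (isClosed_le (continuous_lin w) continuous_const)
      exact this hcl
  · by_cases hA : A.Nonempty
    · obtain ⟨j0, hj0⟩ := hA
      -- The affine span is proper, so some nonzero functional is constant on the generators; it or
      -- its negative separates weakly.
      rw [(convex_hull f A).interior_nonempty_iff_affineSpan_eq_top] at hne
      have hdir : (affineSpan ℝ (hull f A)).direction < ⊤ := by
        rw [lt_top_iff_ne_top]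
        intro htop
        apply hne
        rw [← AffineSubspace.direction_eq_top_iff_of_nonempty]
        · exact htop
        · exact ⟨_, subset_affineSpan ℝ _ (mem_hull f hj0)⟩
      obtain ⟨g, hg0, hg⟩ := Submodule.exists_le_ker_of_lt_top _ hdir
      obtain ⟨w, hw⟩ := exists_lin g
      have hw0 : w ≠ 0 := by
        rintro rfl
        apply hg0
        apply LinearMap.ext
        intro z
        simp [hw, lin]
      have hconst : ∀ j ∈ A, lin w (f j) = lin w (f j0) := by
        intro j hj
        have h1 : f j -ᵥ f j0 ∈ (affineSpan ℝ (hull f A)).direction :=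
          AffineSubspace.vsub_mem_direction (subset_affineSpan ℝ _ (mem_hull f hj))
            (subset_affineSpan ℝ _ (mem_hull f hj0))
        have h2 := hg h1
        rw [LinearMap.mem_ker, vsub_eq_sub, map_sub, hw, hw] at h2
        linarith
      rcases le_total (lin w (f j0)) (lin w z) with h | h
      · exact ⟨w, hw0, fun j hj => by rw [hconst j hj]; exact h⟩
      · refine ⟨-w, neg_ne_zero.mpr hw0, fun j hj => ?_⟩
        rw [lin_neg_left, lin_neg_left, hconst j hj]; linarith
    · refine ⟨1, one_ne_zero, fun j hj => absurd ⟨j, hj⟩ hA⟩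

/-- A point of a finite planar hull that is not interior is one of the points or lies strictly
between two of them. -/
lemma mem_or_between {f : ι → ℂ} {A : Finset ι} {z : ℂ} (hz : z ∈ hull f A)
    (hz' : z ∉ interior (hull f A)) :
    (∃ j ∈ A, f j = z) ∨ ∃ j ∈ A, ∃ l ∈ A, ∃ m : ℝ, 0 < m ∧ m < 1 ∧ f j ≠ f l ∧
      z = (1 - m) • f j + m • f l := by
  classical
  obtain ⟨w, hw, hle⟩ := exists_lin_le hz'
  have hz2 : z ∈ convexHull ℝ ((A.image f : Finset ℂ) : Set ℂ) := by
    rw [Finset.coe_image]; exact hz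
  rw [Finset.mem_convexHull'] at hz2
  obtain ⟨c, hc0, hc1, hcz⟩ := hz2
  have key : ∀ v : ℂ, ∑ y ∈ A.image f, c y * (lin v y - lin v z) = 0 := by
    intro v
    have h1 : lin v z = ∑ y ∈ A.image f, c y * lin v y := by
      conv_lhs => rw [← hcz]
      change linMap v _ = _
      rw [map_sum]
      apply Finset.sum_congr rfl
      intro y _
      change lin v _ = _
      rw [lin_smul]
    simp only [mul_sub, Finset.sum_sub_distrib, ← h1, ← Finset.sum_mul, hc1]
    ring
  -- Since `w` supports the hull at `z`, only generators on the supporting line carry positive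
  -- weight.
  have hon : ∀ y ∈ A.image f, c y * (lin w y - lin w z) = 0 := by
    have h1 : ∀ y ∈ A.image f, c y * (lin w y - lin w z) ≤ 0 := by
      intro y hy
      obtain ⟨j, hj, rfl⟩ := Finset.mem_image.mp hy
      have := hle j hj
      exact mul_nonpos_of_nonneg_of_nonpos (hc0 _ hy) (by linarith)
    exact (Finset.sum_eq_zero_iff_of_nonpos h1).mp (key w)
  set v : ℂ := ⟨-w.im, w.re⟩ with hv
  have hww := lin_self_pos hw
  have recover : ∀ x y : ℂ, lin w x = lin w y → lin v x = lin v y → x = y := by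
    intro x y h1 h2
    simp only [lin, hv] at h1 h2 hww
    have e1 : (w.re * w.re + w.im * w.im) * (x.re - y.re) = 0 := by
      linear_combination w.re * h1 - w.im * h2
    have e2 : (w.re * w.re + w.im * w.im) * (x.im - y.im) = 0 := by
      linear_combination w.im * h1 + w.re * h2
    have e1' := (mul_eq_zero.mp e1).resolve_left hww.ne'
    have e2' := (mul_eq_zero.mp e2).resolve_left hww.ne'
    apply Complex.ext <;> linarith
  -- Along the supporting line, with coordinate `lin v`, either all weighted generators equal `z` or
  -- some lie on both sides of it.
  by_cases hall : ∀ y ∈ A.image f, c y * (lin v y - lin v z) = 0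
  · left
    obtain ⟨y, hy, hcy⟩ : ∃ y ∈ A.image f, c y ≠ 0 := by
      by_contra! hcon
      rw [Finset.sum_eq_zero hcon] at hc1
      exact zero_ne_one hc1
    obtain ⟨j, hj, rfl⟩ := Finset.mem_image.mp hy
    refine ⟨j, hj, recover _ _ ?_ ?_⟩
    · have := (mul_eq_zero.mp (hon _ hy)).resolve_left hcy; linarith
    · have := (mul_eq_zero.mp (hall _ hy)).resolve_left hcy; linarith
  · right
    push Not at hall
    have hneg := key (-v)
    obtain ⟨y1, hy1, hp⟩ := Finset.exists_pos_of_sum_zero_of_exists_nonzero _ (key v) hall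
    obtain ⟨y2, hy2, hp2⟩ := Finset.exists_pos_of_sum_zero_of_exists_nonzero _ (key (-v)) (by
      obtain ⟨y, hy, hne⟩ := hall
      refine ⟨y, hy, fun h => hne ?_⟩
      rw [lin_neg_left, lin_neg_left] at h
      linarith)
    obtain ⟨j, hj, rfl⟩ := Finset.mem_image.mp hy1
    obtain ⟨l, hl, rfl⟩ := Finset.mem_image.mp hy2
    have c1 : 0 < c (f j) := lt_of_le_of_ne (hc0 _ hy1) (fun h => by rw [← h] at hp; simp at hp)
    have c2 : 0 < c (f l) := lt_of_le_of_ne (hc0 _ hy2) (fun h => by rw [← h] at hp2; simp at hp2)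
    have p1 : 0 < lin v (f j) - lin v z := pos_of_mul_pos_right hp c1.le
    have p2 : 0 < lin v z - lin v (f l) := by
      have := pos_of_mul_pos_right hp2 c2.le
      rw [lin_neg_left, lin_neg_left] at this; linarith
    have w1 := (mul_eq_zero.mp (hon _ hy1)).resolve_left c1.ne'
    have w2 := (mul_eq_zero.mp (hon _ hy2)).resolve_left c2.ne'
    have hd : 0 < lin v (f j) - lin v (f l) := by linarith
    refine ⟨j, hj, l, hl, (lin v (f j) - lin v z) / (lin v (f j) - lin v (f l)),
      by positivity, (div_lt_one hd).mpr (by linarith), fun h => by rw [h] at hd; simp at hd, ?_⟩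
    apply recover
    · rw [lin_add, lin_smul, lin_smul]
      have e1 : lin w (f j) = lin w z := by linarith
      have e2 : lin w (f l) = lin w z := by linarith
      rw [e1, e2]; ring
    · rw [lin_add, lin_smul, lin_smul]
      field_simp
      ring

/-- Being outside of a finite hull is an open condition. -/
lemma eventually_notMem_hull {X : Type*} [TopologicalSpace X] {F : X → ι → ℂ} {x : X}
    {A : Finset ι} {e : ι} (hF : ∀ j, ContinuousAt (fun y => F y j) x)
    (he : F x e ∉ hull (F x) A) : ∀ᶠ y in 𝓝 x, F y e ∉ hull (F y) A := by
  obtain ⟨w, hw⟩ := exists_lin_lt he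
  have : ∀ᶠ y in 𝓝 x, ∀ j ∈ A, lin w (F y j) < lin w (F y e) := by
    rw [Filter.eventually_all_finset]
    intro j hj
    exact ((continuous_lin w).continuousAt.comp (hF j)).eventually_lt
      ((continuous_lin w).continuousAt.comp (hF e)) (hw j hj)
  filter_upwards [this] with y hy hmem
  exact lt_irrefl _ (lin_lt_of_mem_hull hy hmem)

/-- Finitely many points in an open half-plane with apex `o` on its boundary have a first one in
counterclockwise order around `o`. -/
lemma exists_first {f : ι → ℂ} {s : Finset ι} (hs : s.Nonempty) {o w : ℂ}
    (h : ∀ j ∈ s, lin w o < lin w (f j)) : ∃ c ∈ s, ∀ j ∈ s, 0 ≤ cr o (f c) (f j) := by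
  -- The quotient is the tangent of the angle from `w` to `f j - o`, which increases over the open
  -- half-plane.
  obtain ⟨c, hc, hmin⟩ := s.exists_min_image
    (fun j => (w.re * ((f j).im - o.im) - w.im * ((f j).re - o.re)) / (lin w (f j) - lin w o)) hs
  refine ⟨c, hc, fun j hj => ?_⟩
  have h1 := h j hj
  have h2 := h c hc
  have h3 := hmin j hj
  rw [div_le_div_iff₀ (by linarith) (by linarith)] at h3
  have hw : w ≠ 0 := by
    rintro rfl
    simp [lin] at h1
  have h4 := lin_self_pos hw
  have h5 : lin w w * cr o (f c) (f j) = (w.re * ((f j).im - o.im) - w.im * ((f j).re - o.re)) *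
      (lin w (f c) - lin w o) - (w.re * ((f c).im - o.im) - w.im * ((f c).re - o.re)) *
      (lin w (f j) - lin w o) := by
    simp only [lin, cr]; ring
  by_contra! hneg
  have := mul_neg_of_pos_of_neg h4 hneg
  linarith

/-- Finitely many points in an open half-plane with apex `o` on its boundary have a last one in
counterclockwise order around `o`. -/
lemma exists_last {f : ι → ℂ} {s : Finset ι} (hs : s.Nonempty) {o w : ℂ}
    (h : ∀ j ∈ s, lin w o < lin w (f j)) : ∃ c ∈ s, ∀ j ∈ s, 0 ≤ cr o (f j) (f c) := by
  -- Complex conjugation reverses orientation, turning the last point into the first.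
  have conj_lin : ∀ z, lin (starRingEnd ℂ w) (starRingEnd ℂ z) = lin w z := by
    intro z; simp [lin]
  obtain ⟨c, hc, hcj⟩ := exists_first (f := fun j => starRingEnd ℂ (f j)) hs
    (o := starRingEnd ℂ o) (w := starRingEnd ℂ w) (fun j hj => by
      rw [conj_lin, conj_lin]; exact h j hj)
  refine ⟨c, hc, fun j hj => ?_⟩
  have := hcj j hj
  simp only [cr, Complex.conj_re, Complex.conj_im] at this ⊢
  linarith

/-- The family `f` has no three collinear members. -/
def Gen (f : ι → ℂ) : Prop := ∀ i j l, i ≠ j → i ≠ l → j ≠ l → cr (f i) (f j) (f l) ≠ 0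

lemma cr_comb_eq_zero (a b : ℂ) (m : ℝ) : cr a ((1 - m) • a + m • b) b = 0 := by
  simp only [cr, Complex.add_re, Complex.add_im, Complex.real_smul, Complex.mul_re, Complex.mul_im,
    Complex.ofReal_re, Complex.ofReal_im]
  ring

/-- A boundary point of the hull that is not a generator lies between two generators, which would be
a collinear triple. -/
lemma Gen.mem_interior {f : ι → ℂ} (hf : Function.Injective f) (hg : Gen f) {A : Finset ι} {j : ι}
    (hj : j ∉ A) (h : f j ∈ hull f A) : f j ∈ interior (hull f A) := by
  by_contra hn
  rcases mem_or_between h hn with ⟨l, hl, he⟩ | ⟨i, hi, l, hl, m, _, _, hil, he⟩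
  · rw [hf he] at hl; exact hj hl
  · refine hg i j l (fun h => hj (h ▸ hi)) (fun h => hil (by rw [h])) (fun h => hj (h ▸ hl)) ?_
    rw [he]
    exact cr_comb_eq_zero _ _ _

/-- A hull with nonempty interior has at least three generators. -/
lemma three_le_card {f : ι → ℂ} {A : Finset ι} {z : ℂ} (hz : z ∈ interior (hull f A)) :
    3 ≤ A.card := by
  by_contra! hlt
  have hline : ∃ w : ℂ, w ≠ 0 ∧ ∃ c, ∀ j ∈ A, lin w (f j) = c := by
    have h2 : A.card = 0 ∨ A.card = 1 ∨ A.card = 2 := by omega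
    rcases h2 with h2 | h2 | h2
    · rw [Finset.card_eq_zero] at h2
      exact ⟨1, one_ne_zero, 0, by simp [h2]⟩
    · obtain ⟨a, rfl⟩ := Finset.card_eq_one.mp h2
      exact ⟨1, one_ne_zero, lin 1 (f a), by simp⟩
    · classical
      obtain ⟨a, b, _, rfl⟩ := Finset.card_eq_two.mp h2
      by_cases hab : f a = f b
      · exact ⟨1, one_ne_zero, lin 1 (f a), by simp [hab]⟩
      · refine ⟨nrm (f a) (f b), nrm_ne_zero hab, lin (nrm (f a) (f b)) (f a), ?_⟩
        simp only [Finset.mem_insert, Finset.mem_singleton, forall_eq_or_imp, forall_eq, true_and]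
        have := cr_eq_lin (f a) (f b) (f b)
        rw [cr_self_right] at this
        linarith
  obtain ⟨w, hw, c, hc⟩ := hline
  have h1 := lin_lt_of_mem_interior hw (fun j hj => (hc j hj).le) hz
  have h2 := lin_lt_of_mem_interior (w := -w) (c := -c) (neg_ne_zero.mpr hw)
    (fun j hj => by rw [lin_neg_left, hc j hj]) hz
  rw [lin_neg_left] at h2
  linarith

end Hull

/-! ### The weak property in terms of indexed families. -/

section Bounds

variable {ι : Type*} [Fintype ι] [DecidableEq ι]

open Classical in
/-- The indices outside of `A` whose points are interior to the hull of `A`. -/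
noncomputable def inn (f : ι → ℂ) (A : Finset ι) : Finset ι :=
  Finset.univ.filter fun j => j ∉ A ∧ f j ∈ interior (hull f A)

lemma mem_inn {f : ι → ℂ} {A : Finset ι} {j : ι} :
    j ∈ inn f A ↔ j ∉ A ∧ f j ∈ interior (hull f A) := by
  simp [inn]

/-- Every hull contains at most `|A| - 3 + k` further points in its interior. -/
def Bdd (k : ℕ) (f : ι → ℂ) : Prop :=
  ∀ A : Finset ι, (inn f A).Nonempty → (inn f A).card + 3 ≤ A.card + k

/-- All collinear triples have the same underlying set. -/
def UniqueCol (f : ι → ℂ) : Prop :=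
  ∀ i j l i' j' l', i ≠ j → i ≠ l → j ≠ l → i' ≠ j' → i' ≠ l' → j' ≠ l' →
    cr (f i) (f j) (f l) = 0 → cr (f i') (f j') (f l') = 0 →
    ({i, j, l} : Finset ι) = {i', j', l'}

omit [Fintype ι] in
lemma Gen.uniqueCol {f : ι → ℂ} (h : Gen f) : UniqueCol f :=
  fun i j l _ _ _ h1 h2 h3 _ _ _ h0 _ => absurd h0 (h i j l h1 h2 h3)

lemma collinear_iff_cr (a b c : ℂ) (hab : a ≠ b) :
    Collinear ℝ ({a, b, c} : Set ℂ) ↔ cr a b c = 0 := by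
  rw [collinear_iff_of_mem (p₀ := a) (by simp)]
  constructor
  · rintro ⟨v, hv⟩
    obtain ⟨r, hr⟩ := hv b (by simp)
    obtain ⟨t, ht⟩ := hv c (by simp)
    rw [hr, ht]
    simp only [cr, vadd_eq_add, Complex.add_re, Complex.add_im, Complex.real_smul, Complex.mul_re,
      Complex.mul_im, Complex.ofReal_re, Complex.ofReal_im]
    ring
  · intro h
    have hn : (b.re - a.re) ^ 2 + (b.im - a.im) ^ 2 ≠ 0 := by
      intro h0
      apply hab
      have h1 : (b.re - a.re) ^ 2 = 0 := by nlinarith [sq_nonneg (b.re - a.re), sq_nonneg (b.im - a.im)]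
      have h2 : (b.im - a.im) ^ 2 = 0 := by nlinarith [sq_nonneg (b.re - a.re), sq_nonneg (b.im - a.im)]
      have h1' := pow_eq_zero_iff (two_ne_zero) |>.mp h1
      have h2' := pow_eq_zero_iff (two_ne_zero) |>.mp h2
      apply Complex.ext <;> linarith
    refine ⟨b - a, ?_⟩
    rintro p (rfl | rfl | rfl)
    · exact ⟨0, by simp⟩
    · exact ⟨1, by simp⟩
    · refine ⟨((b.re - a.re) * (p.re - a.re) + (b.im - a.im) * (p.im - a.im)) /
        ((b.re - a.re) ^ 2 + (b.im - a.im) ^ 2), ?_⟩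
      unfold cr at h
      apply Complex.ext
      · simp only [vadd_eq_add, Complex.add_re, Complex.real_smul, Complex.mul_re, Complex.sub_re,
          Complex.sub_im, Complex.ofReal_re, Complex.ofReal_im]
        field_simp
        linear_combination (-(b.im - a.im)) * h
      · simp only [vadd_eq_add, Complex.add_im, Complex.real_smul, Complex.mul_im, Complex.sub_re,
          Complex.sub_im, Complex.ofReal_re, Complex.ofReal_im]
        field_simp
        linear_combination (b.re - a.re) * h

omit [Fintype ι] [DecidableEq ι] in
open Classical in
/-- The generators that are not interior to a hull already span it. -/
lemma hull_filter_notMem_interior (f : ι → ℂ) (A : Finset ι) :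
    hull f (A.filter fun j => f j ∉ interior (hull f A)) = hull f A := by
  apply subset_antisymm (hull_mono f (Finset.filter_subset _ _))
  have hc : IsCompact (hull f A) := (A.finite_toSet.image f).isCompact_convexHull (𝕜 := ℝ)
  have h1 := closure_convexHull_extremePoints hc (convex_hull f A)
  conv_lhs => rw [← h1]
  apply closure_minimal _ (isClosed_hull _ _)
  apply convexHull_min _ (convex_hull _ _)
  intro x hx
  obtain ⟨j, hj, rfl⟩ := extremePoints_convexHull_subset hx
  apply mem_hull
  rw [Finset.mem_filter]
  refine ⟨by exact_mod_cast hj, fun hint => ?_⟩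
  exact (disjoint_interior_extremePoints (hull f A)).le_bot ⟨hint, hx⟩

omit [Fintype ι] [DecidableEq ι] in
open Classical in
lemma coe_image_eq (f : ι → ℂ) (A : Finset ι) :
    convexHull ℝ ((A.image f : Finset ℂ) : Set ℂ) = hull f A := by
  rw [Finset.coe_image]; rfl

omit [DecidableEq ι] in
open Classical in
lemma intPoints_image (f : ι → ℂ) (A : Finset ι) :
    intPoints (Finset.univ.image f) (A.image f) =
      (Finset.univ.filter fun j => f j ∈ interior (hull f A)).image f := by
  ext z
  simp only [intPoints, coe_image_eq, Finset.mem_filter, Finset.mem_image, Finset.mem_univ,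
    true_and]
  constructor
  · rintro ⟨⟨j, rfl⟩, h⟩; exact ⟨j, h, rfl⟩
  · rintro ⟨j, h, rfl⟩; exact ⟨⟨j, rfl⟩, h⟩

open Classical in
lemma triple_mem_collinearTriples {f : ι → ℂ} (hf : Function.Injective f) {i j l : ι}
    (hij : i ≠ j) (hil : i ≠ l) (hjl : j ≠ l) (h : cr (f i) (f j) (f l) = 0) :
    ({i, j, l} : Finset ι).image f ∈ collinearTriples (Finset.univ.image f) := by
  simp only [collinearTriples, Finset.mem_filter, Finset.mem_powersetCard]
  refine ⟨⟨Finset.image_subset_image (Finset.subset_univ _), ?_⟩, ?_⟩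
  · rw [Finset.card_image_of_injective _ hf, Finset.card_eq_three]
    exact ⟨i, j, l, hij, hil, hjl, rfl⟩
  · have := (collinear_iff_cr (f i) (f j) (f l) (hf.ne hij)).mpr h
    simpa [Finset.coe_image, Set.image_insert_eq] using this

-- `Bdd` drops the convexity requirement on `A`. Discarding the members of `A` interior to its hull
-- leaves a convex set with the same hull and no more elements, so the bound for convex sets implies
-- the one for all sets. Conversely, for convex `A` all interior points lie outside `A`.
open Classical in
theorem weakDelta_iff {k : ℕ} {f : ι → ℂ} (hf : Function.Injective f) :
    WeakDelta k (Finset.univ.image f) ↔ UniqueCol f ∧ Bdd k f := by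
  have himg : ∀ T : Finset ℂ, T ⊆ Finset.univ.image f → ∃ S : Finset ι, S.image f = T := by
    intro T hT
    obtain ⟨S, _, hS⟩ := Finset.subset_image_iff.mp hT
    exact ⟨S, hS⟩
  constructor
  · rintro ⟨h1, h2⟩
    constructor
    · intro i j l i' j' l' a1 a2 a3 b1 b2 b3 hc hc'
      have := Finset.card_le_one.mp h1 _ (triple_mem_collinearTriples hf a1 a2 a3 hc) _
        (triple_mem_collinearTriples hf b1 b2 b3 hc')
      exact Finset.image_injective hf this
    · intro A hne
      set V := A.filter fun j => f j ∉ interior (hull f A) with hV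
      have hVA : hull f V = hull f A := hull_filter_notMem_interior f A
      obtain ⟨e, he⟩ := hne
      have h3 : 3 ≤ V.card := three_le_card (f := f) (z := f e) (by
        rw [hVA]; exact (mem_inn.mp he).2)
      have h4 := h2 (V.image f) ⟨Finset.image_subset_image (Finset.subset_univ _), ?_⟩ ?_
      · rw [intPoints_image, Finset.card_image_of_injective _ hf,
          Finset.card_image_of_injective _ hf, hVA] at h4
        have h5 : (inn f A).card ≤ (Finset.univ.filter fun j => f j ∈ interior (hull f A)).card := by
          apply Finset.card_le_card
          intro j hj
          simpa using (mem_inn.mp hj).2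
        have h6 : V.card ≤ A.card := Finset.card_filter_le _ _
        omega
      · rw [intPoints_image, Finset.disjoint_left]
        intro z hz hz'
        obtain ⟨j, hj, rfl⟩ := Finset.mem_image.mp hz
        obtain ⟨l, hl, hle⟩ := Finset.mem_image.mp hz'
        rw [hf hle, hV, Finset.mem_filter] at hl
        rw [Finset.mem_filter, hVA] at hj
        exact hl.2 hj.2
      · rwa [Finset.card_image_of_injective _ hf]
  · rintro ⟨h1, h2⟩
    constructor
    · rw [Finset.card_le_one]
      intro T hT T' hT'
      simp only [collinearTriples, Finset.mem_filter, Finset.mem_powersetCard] at hT hT'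
      obtain ⟨⟨hs, hc⟩, hcol⟩ := hT
      obtain ⟨⟨hs', hc'⟩, hcol'⟩ := hT'
      obtain ⟨S, rfl⟩ := himg T hs
      obtain ⟨S', rfl⟩ := himg T' hs'
      rw [Finset.card_image_of_injective _ hf, Finset.card_eq_three] at hc hc'
      obtain ⟨i, j, l, a1, a2, a3, rfl⟩ := hc
      obtain ⟨i', j', l', b1, b2, b3, rfl⟩ := hc'
      congr 1
      apply h1 _ _ _ _ _ _ a1 a2 a3 b1 b2 b3
      · rw [← collinear_iff_cr _ _ _ (hf.ne a1)]
        simpa [Finset.coe_image, Set.image_insert_eq] using hcol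
      · rw [← collinear_iff_cr _ _ _ (hf.ne b1)]
        simpa [Finset.coe_image, Set.image_insert_eq] using hcol'
    · rintro A ⟨hA, hd⟩ h3
      obtain ⟨S, rfl⟩ := himg A hA
      rw [Finset.card_image_of_injective _ hf] at h3 ⊢
      rw [intPoints_image] at hd ⊢
      rw [Finset.card_image_of_injective _ hf]
      have h5 : (Finset.univ.filter fun j => f j ∈ interior (hull f S)) = inn f S := by
        ext j
        rw [mem_inn, Finset.mem_filter]
        refine ⟨fun h => ⟨fun hj => ?_, h.2⟩, fun h => ⟨Finset.mem_univ _, h.2⟩⟩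
        exact Finset.disjoint_left.mp hd (Finset.mem_image_of_mem f (Finset.mem_filter.mpr h))
          (Finset.mem_image_of_mem f hj)
      rw [h5]
      rcases (inn f S).eq_empty_or_nonempty with h | h
      · simp [h]
      · have := h2 S h
        omega

end Bounds

/-! ### The core, and a hull edge that sees it in a single point. -/

section Edge

variable {ι : Type*} [Fintype ι] [DecidableEq ι]

open Classical in
/-- The indices of the points interior to the hull of the whole family. -/
noncomputable def core (f : ι → ℂ) : Finset ι :=
  Finset.univ.filter fun j => f j ∈ interior (hull f Finset.univ)

omit [DecidableEq ι] in
lemma mem_core {f : ι → ℂ} {j : ι} : j ∈ core f ↔ f j ∈ interior (hull f Finset.univ) := by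
  simp [core]

/-- In general position a point in the hull of the others is interior, so every non-core point is
strictly exposed. -/
lemma exists_lin_lt_of_notMem_core {f : ι → ℂ} (hf : Function.Injective f) (hg : Gen f) {j : ι}
    (hj : j ∉ core f) : ∃ w, ∀ i, i ≠ j → lin w (f i) < lin w (f j) := by
  have h : f j ∉ hull f (Finset.univ.erase j) := by
    intro h
    exact hj (mem_core.mpr (interior_mono (hull_mono f (Finset.subset_univ _))
      (hg.mem_interior hf (Finset.notMem_erase _ _) h)))
  obtain ⟨w, hw⟩ := exists_lin_lt h
  exact ⟨w, fun i hi => hw i (by simp [hi])⟩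

omit [DecidableEq ι] in
lemma notMem_core_of_forall_le {f : ι → ℂ} {j : ι} {w : ℂ} (hw : w ≠ 0)
    (h : ∀ i, lin w (f i) ≤ lin w (f j)) : j ∉ core f := by
  intro hj
  exact lt_irrefl _ (lin_lt_of_mem_interior hw (fun i _ => h i) (mem_core.mp hj))

/-- `a b` is a counterclockwise edge of the hull of the family `f`. -/
def HullEdge (f : ι → ℂ) (a b : ι) : Prop :=
  a ≠ b ∧ ∀ j, j ≠ a → j ≠ b → 0 < cr (f a) (f b) (f j)

omit [Fintype ι] [DecidableEq ι] in
lemma HullEdge.nonneg {f : ι → ℂ} {a b : ι} (h : HullEdge f a b) (j : ι) :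
    0 ≤ cr (f a) (f b) (f j) := by
  by_cases h1 : j = a
  · rw [h1, cr_self_left]
  · by_cases h2 : j = b
    · rw [h2, cr_self_right]
    · exact (h.2 j h1 h2).le

omit [DecidableEq ι] in
lemma HullEdge.core_pos {f : ι → ℂ} (hf : Function.Injective f) {a b : ι} (h : HullEdge f a b)
    {e : ι} (he : e ∈ core f) : 0 < cr (f a) (f b) (f e) :=
  cr_pos_of_mem_interior (hf.ne h.1) (fun j _ => h.nonneg j) (mem_core.mp he)

omit [DecidableEq ι] in
lemma HullEdge.left_notMem {f : ι → ℂ} (hf : Function.Injective f) {a b : ι} (h : HullEdge f a b) :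
    a ∉ core f := fun ha => by
  have := h.core_pos hf ha
  rw [cr_self_left] at this
  exact lt_irrefl _ this

omit [DecidableEq ι] in
lemma HullEdge.right_notMem {f : ι → ℂ} (hf : Function.Injective f) {a b : ι} (h : HullEdge f a b) :
    b ∉ core f := fun ha => by
  have := h.core_pos hf ha
  rw [cr_self_right] at this
  exact lt_irrefl _ this

omit [DecidableEq ι] in
lemma ne_of_mem_of_notMem_core {f : ι → ℂ} {e b : ι} (he : e ∈ core f) (hb : b ∉ core f) :
    e ≠ b := fun h => hb (h ▸ he)

/-- Seen from an exposed point `b`, the others lie in an open half-plane; the first of them in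
counterclockwise order is the next vertex. -/
lemma exists_hullEdge {f : ι → ℂ} (hf : Function.Injective f) (hg : Gen f) {b : ι}
    (hb : b ∉ core f) (hne : (core f).Nonempty) : ∃ c, HullEdge f b c := by
  obtain ⟨w, hw⟩ := exists_lin_lt_of_notMem_core hf hg hb
  obtain ⟨e, he⟩ := hne
  obtain ⟨c, hc, hcj⟩ := exists_first (f := f) (s := Finset.univ.erase b) (o := f b) (w := -w)
    ⟨e, by simpa using ne_of_mem_of_notMem_core he hb⟩ (fun j hj => by
      rw [lin_neg_left, lin_neg_left]
      have := hw j (by simpa using hj)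
      linarith)
  have hcb : b ≠ c := by
    intro h; simp [h] at hc
  refine ⟨c, hcb, fun j h1 h2 => ?_⟩
  exact lt_of_le_of_ne (hcj j (by simpa using h1)) (hg b c j hcb h1.symm h2.symm).symm

/-- `u p` is a counterclockwise edge of the hull of the core of `f`. -/
def CoreEdge (f : ι → ℂ) (u p : ι) : Prop :=
  u ≠ p ∧ ∀ e ∈ core f, e ≠ u → e ≠ p → 0 < cr (f u) (f p) (f e)

omit [DecidableEq ι] in
lemma CoreEdge.nonneg {f : ι → ℂ} {u p : ι} (h : CoreEdge f u p) {e : ι} (he : e ∈ core f) :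
    0 ≤ cr (f u) (f p) (f e) := by
  by_cases h1 : e = u
  · rw [h1, cr_self_left]
  · by_cases h2 : e = p
    · rw [h2, cr_self_right]
    · exact (h.2 e he h1 h2).le

/-- The core point `p` lies in every triangle formed by `a b` and another core point. -/
def Sees (f : ι → ℂ) (a b p : ι) : Prop :=
  ∀ e ∈ core f, e ≠ p → 0 < cr (f a) (f p) (f e) ∧ 0 < cr (f p) (f b) (f e)

/-- A hull edge that does not see the core in a single point lies beyond an edge of the core. -/
lemma exists_coreEdge {f : ι → ℂ} (hf : Function.Injective f) (hg : Gen f)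
    (hne : (core f).Nonempty) {a b : ι} (hab : HullEdge f a b)
    (hbad : ∀ p ∈ core f, ¬ Sees f a b p) :
    ∃ u ∈ core f, ∃ p ∈ core f, CoreEdge f u p ∧ cr (f u) (f p) (f a) < 0 ∧
      cr (f u) (f p) (f b) < 0 := by
  have ha := hab.left_notMem hf
  have hb := hab.right_notMem hf
  have hpos : ∀ j ∈ core f, lin (nrm (f a) (f b)) (f a) < lin (nrm (f a) (f b)) (f j) := by
    intro j hj
    have := hab.core_pos hf hj
    rw [cr_eq_lin] at this
    linarith
  obtain ⟨p, hp, hpj⟩ := exists_first hne hpos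
  have hap : a ≠ p := (ne_of_mem_of_notMem_core hp ha).symm
  have hbp : b ≠ p := (ne_of_mem_of_notMem_core hp hb).symm
  have hpj' : ∀ e ∈ core f, e ≠ p → 0 < cr (f a) (f p) (f e) := fun e he hep =>
    lt_of_le_of_ne (hpj e he) (hg a p e hap (ne_of_mem_of_notMem_core he ha).symm hep.symm).symm
  -- As `p` is the first core point around `a`, `Sees` can fail only through a core point `e0` on
  -- the wrong side of the line `p b`.
  have h0 := hbad p hp
  unfold Sees at h0
  push Not at h0
  obtain ⟨e0, he0, hne0, hle⟩ := h0
  have hlt : cr (f p) (f b) (f e0) < 0 := lt_of_le_of_ne (hle (hpj' e0 he0 hne0))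
    (hg p b e0 hbp.symm hne0.symm (ne_of_mem_of_notMem_core he0 hb).symm)
  -- The other core points all lie to the left of `a p`; the last of them around `p` is the
  -- neighbour of `p` on the hull of the core.
  obtain ⟨u, hu, huj⟩ := exists_last (f := f) (s := (core f).erase p) (o := f p)
    (w := nrm (f a) (f p)) ⟨e0, by simp [hne0, he0]⟩ (fun j hj => by
      rw [Finset.mem_erase] at hj
      have := hpj' j hj.2 hj.1
      rw [cr_eq_lin] at this
      have h2 := cr_eq_lin (f a) (f p) (f p)
      rw [cr_self_right] at h2
      linarith)
  rw [Finset.mem_erase] at hu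
  have hedge : CoreEdge f u p := by
    refine ⟨hu.1, fun e he heu hep => ?_⟩
    have := huj e (by simp [he, hep])
    rw [← cr_rotate] at this
    exact lt_of_le_of_ne this (hg u p e hu.1 heu.symm hep.symm).symm
  have hau := hpj' u hu.2 hu.1
  refine ⟨u, hu.2, p, hp, hedge, ?_, ?_⟩
  · rw [cr_rotate] at hau
    have := cr_swap (f p) (f u) (f a)
    linarith
  · by_cases hue : u = e0
    · rw [hue, cr_rotate]; exact hlt
    · have h1 := hedge.2 e0 he0 (Ne.symm hue) hne0
      have h2 := hpj' e0 he0 hne0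
      have h3 := hab.core_pos hf hp
      -- The three-term Grassmann–Plücker relation for the vectors from `p` to `a`, `b`, `u`, `e0`.
      have key : cr (f a) (f p) (f e0) * cr (f u) (f p) (f b) =
          - (cr (f a) (f b) (f p) * cr (f u) (f p) (f e0)) +
          cr (f a) (f p) (f u) * cr (f p) (f b) (f e0) := by
        unfold cr; ring
      have h4 := mul_pos h3 h1
      have h5 := mul_neg_of_pos_of_neg hau hlt
      by_contra! hcon
      have h6 := mul_nonneg h2.le hcon
      linarith

/-- Among the non-core points beyond a given core edge starting at `u`, the last one. -/
lemma exists_last_beyond {f : ι → ℂ} (hf : Function.Injective f) (hg : Gen f) {b0 : ι}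
    (hb0 : b0 ∉ core f) {u : ι} (hu : u ∈ core f) :
    ∃ b, b ∉ core f ∧ ∀ p ∈ core f, CoreEdge f u p → ∀ b', b' ∉ core f → b' ≠ b →
      cr (f u) (f p) (f b') < 0 → ∀ e ∈ core f, 0 < cr (f b') (f b) (f e) := by
  by_cases hex : ∃ p ∈ core f, CoreEdge f u p ∧ ∃ b', b' ∉ core f ∧ cr (f u) (f p) (f b') < 0
  swap
  · exact ⟨b0, hb0, fun p hp hup b' hb' _ hlt => absurd ⟨p, hp, hup, b', hb', hlt⟩ hex⟩
  obtain ⟨p, hp, hup, b1, hb1, hb1p⟩ := hex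
  classical
  obtain ⟨b, hb, hbj⟩ := exists_last (f := f)
    (s := Finset.univ.filter fun j => j ∉ core f ∧ cr (f u) (f p) (f j) < 0) (o := f u)
    (w := -nrm (f u) (f p)) ⟨b1, by simp [hb1, hb1p]⟩ (fun j hj => by
      rw [Finset.mem_filter] at hj
      have := hj.2.2
      rw [cr_eq_lin] at this
      rw [lin_neg_left, lin_neg_left]
      linarith)
  rw [Finset.mem_filter] at hb
  obtain ⟨-, hbc, hbp⟩ := hb
  refine ⟨b, hbc, ?_⟩
  intro p' hp' hup' b' hb' hbb' hlt e he
  -- At most one core edge starts at `u`, so the choice of `b` does not depend on the edge.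
  have hpp : p' = p := by
    by_contra hne
    have h1 := hup.2 p' hp' hup'.1.symm hne
    have h2 := hup'.2 p hp hup.1.symm (Ne.symm hne)
    have := cr_swap_right (f u) (f p) (f p')
    linarith
  subst hpp
  have hub : u ≠ b := ne_of_mem_of_notMem_core hu hbc
  have hub' : u ≠ b' := ne_of_mem_of_notMem_core hu hb'
  have h1 : 0 < cr (f u) (f b') (f b) :=
    lt_of_le_of_ne (hbj b' (by simp [hb', hlt])) (hg u b' b hub' hub hbb').symm
  by_contra! hcon
  -- If `e` lay to the right of `b' b`, the segment from `u` to `e` would cross this line at a point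
  -- `z` on the closed inner side of the core edge, while `b` and `b'` are strictly beyond that
  -- edge.
  have h2 : cr (f b') (f b) (f e) < 0 := lt_of_le_of_ne hcon
    (hg b' b e hbb' (ne_of_mem_of_notMem_core he hb').symm (ne_of_mem_of_notMem_core he hbc).symm)
  have h3 := hup.nonneg he
  obtain ⟨v, hv⟩ := exists_lin_lt_of_notMem_core hf hg hbc
  obtain ⟨v', hv'⟩ := exists_lin_lt_of_notMem_core hf hg hb'
  have v1 := hv b' hbb'
  have v2 := hv u hub
  have v3 := hv e (ne_of_mem_of_notMem_core he hbc)
  have w1 := hv' b hbb'.symm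
  have w2 := hv' u hub'
  have w3 := hv' e (ne_of_mem_of_notMem_core he hb')
  -- the point `z = x u + y e` on the line `b' b`, in homogeneous form
  rw [cr_rotate] at h1
  set x := -cr (f b') (f b) (f e) with hx
  set y := cr (f b') (f b) (f u) with hy
  have hx0 : 0 < x := by linarith
  set B := cr (f u) (f p') (f b) with hB
  set B' := cr (f u) (f p') (f b') with hB'
  set E := cr (f u) (f p') (f e) with hE
  -- barycentric identities on the line `b' b`
  have id1 : (B' - B) * (x * lin v (f u) + y * lin v (f e)) =
      (x + y) * (B' * lin v (f b) - B * lin v (f b')) + (y * E) * (lin v (f b') - lin v (f b)) := by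
    simp only [hx, hy, hB, hB', hE, cr, lin]; ring
  have id2 : (B' - B) * (x * lin v' (f u) + y * lin v' (f e)) =
      (x + y) * (B' * lin v' (f b) - B * lin v' (f b')) +
        (y * E) * (lin v' (f b') - lin v' (f b)) := by
    simp only [hx, hy, hB, hB', hE, cr, lin]; ring
  have hyE : 0 ≤ y * E := mul_nonneg h1.le h3
  -- Whichever of `b`, `b'` is nearer to the core edge lies between `z` and the other one, although
  -- it is exposed.
  rcases le_total B B' with hBB | hBB
  · have e1 : x * lin v' (f u) + y * lin v' (f e) ≤ (x + y) * lin v' (f b') := by nlinarith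
    nlinarith [mul_pos (add_pos hx0 h1) (mul_pos (neg_pos.mpr hlt) (sub_pos.mpr w1)),
      mul_nonneg (sub_nonneg.mpr hBB) (sub_nonneg.mpr e1), mul_nonneg hyE (sub_nonneg.mpr w1.le)]
  · have e1 : x * lin v (f u) + y * lin v (f e) ≤ (x + y) * lin v (f b) := by nlinarith
    nlinarith [mul_pos (add_pos hx0 h1) (mul_pos (neg_pos.mpr hbp) (sub_pos.mpr v1)),
      mul_nonneg (sub_nonneg.mpr hBB) (sub_nonneg.mpr e1), mul_nonneg hyE (sub_nonneg.mpr v1.le)]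

/-- If the hulls contain few interior points, some hull edge sees the core in a single point. -/
theorem exists_sees {k : ℕ} {f : ι → ℂ} (hf : Function.Injective f) (hg : Gen f) (hb : Bdd k f)
    (hk : k ≤ 2) (hne : (core f).Nonempty) :
    ∃ a b p, HullEdge f a b ∧ p ∈ core f ∧ Sees f a b p := by
  by_contra! hbad
  have hE : ∃ b0, b0 ∉ core f := by
    by_contra! hall
    obtain ⟨j0, hj0⟩ := hne
    obtain ⟨j, _, hmax⟩ := Finset.univ.exists_max_image (fun j => lin 1 (f j)) ⟨j0, by simp⟩
    exact notMem_core_of_forall_le one_ne_zero (fun i => hmax i (by simp)) (hall j)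
  obtain ⟨b0, hb0⟩ := hE
  choose! g hgE hgl using fun u (hu : u ∈ core f) => exists_last_beyond hf hg hb0 hu
  set B := (core f).image g with hB
  have hBE : ∀ b ∈ B, b ∉ core f := by
    intro b hb
    obtain ⟨u, hu, rfl⟩ := Finset.mem_image.mp hb
    exact hgE u hu
  have hBne : B.Nonempty := hne.image g
  -- If `e` were outside the hull of `B`, take the last point `b` of `B` around `e` and the hull
  -- edge `b c`. It lies beyond a core edge starting at some `u`. Either `b = g u`, and the position
  -- of `c` contradicts the choice of `g u`, or `g u` comes after `b` around `e`.
  have hsub : core f ⊆ inn f B := by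
    intro e he
    have heB : e ∉ B := fun h => hBE e h he
    rw [mem_inn]
    refine ⟨heB, hg.mem_interior hf heB ?_⟩
    by_contra hout
    obtain ⟨w, hw⟩ := exists_lin_lt hout
    obtain ⟨b, hbB, hmax⟩ := exists_last (f := f) (o := f e) (w := -w) hBne (fun j hj => by
      rw [lin_neg_left, lin_neg_left]
      have := hw j hj
      linarith)
    have hbc := hBE b hbB
    obtain ⟨c, hbcE⟩ := exists_hullEdge hf hg hbc hne
    have hcc := hbcE.right_notMem hf
    obtain ⟨u, hu, p, hp, hup, hub, huc⟩ := exists_coreEdge hf hg hne hbcE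
      (fun p hp => hbad b c p hbcE hp)
    by_cases hbg : b = g u
    · have h1 := hgl u hu p hp hup c hcc (by rw [← hbg]; exact hbcE.1.symm) huc e he
      rw [← hbg] at h1
      have h2 := hbcE.core_pos hf he
      have := cr_swap (f b) (f c) (f e)
      linarith
    · have h1 := hgl u hu p hp hup b hbc hbg hub e he
      have h2 := hmax (g u) (Finset.mem_image_of_mem g hu)
      have h3 := cr_swap_right (f e) (f b) (f (g u))
      rw [← cr_rotate] at h1
      linarith
  have h1 := hb B (hne.mono hsub)
  have h2 := Finset.card_le_card hsub
  have h3 : B.card ≤ (core f).card := Finset.card_image_le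
  -- The three estimates give `|core| + 3 ≤ |B| + k ≤ |core| + 2`.
  omega

end Edge

/-! ### The bound survives while the seen point moves towards the edge. -/

section Move

variable {ι : Type*} [Fintype ι] [DecidableEq ι]

/-- The triangle over a hull edge at the point it sees contains no further point of the family. -/
lemma Sees.triangle_empty {f : ι → ℂ} (hf : Function.Injective f) (hg : Gen f) {a b p : ι}
    (hab : HullEdge f a b) (hp : p ∈ core f) (hs : Sees f a b p) {c : ι} (hca : c ≠ a)
    (hcb : c ≠ b) (hcp : c ≠ p) (h1 : 0 ≤ cr (f p) (f c) (f b)) :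
    cr (f p) (f a) (f c) < 0 := by
  by_contra! h2
  by_cases hc : c ∈ core f
  · have := (hs c hc hcp).1
    rw [cr_swap] at this
    linarith
  -- A non-core point is exposed, yet `c` would be a convex combination of `a`, `b` and `p`.
  · obtain ⟨v, hv⟩ := exists_lin_lt_of_notMem_core hf hg hc
    have va := hv a hca.symm
    have vb := hv b hcb.symm
    have vp := hv p hcp.symm
    have h3 := hab.nonneg c
    have h4 := hab.core_pos hf hp
    have key : cr (f a) (f b) (f p) * lin v (f c) = cr (f p) (f c) (f b) * lin v (f a) +
        cr (f p) (f a) (f c) * lin v (f b) + cr (f a) (f b) (f c) * lin v (f p) := by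
      simp only [cr, lin]; ring
    have key2 : cr (f a) (f b) (f p) = cr (f p) (f c) (f b) +
        cr (f p) (f a) (f c) + cr (f a) (f b) (f c) := by
      simp only [cr]; ring
    have key3 : cr (f p) (f c) (f b) * (lin v (f c) - lin v (f a)) +
        cr (f p) (f a) (f c) * (lin v (f c) - lin v (f b)) +
        cr (f a) (f b) (f c) * (lin v (f c) - lin v (f p)) = 0 := by
      linear_combination (-lin v (f c)) * key2 + key
    have t1 := mul_nonneg h1 (sub_pos.mpr va).le
    have t2 := mul_nonneg h2 (sub_pos.mpr vb).le
    have t3 := mul_nonneg h3 (sub_pos.mpr vp).le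
    have z1 : cr (f p) (f c) (f b) = 0 :=
      (mul_eq_zero.mp (by linarith : cr (f p) (f c) (f b) * (lin v (f c) - lin v (f a)) = 0)).resolve_right
        (sub_pos.mpr va).ne'
    have z2 : cr (f p) (f a) (f c) = 0 :=
      (mul_eq_zero.mp (by linarith : cr (f p) (f a) (f c) * (lin v (f c) - lin v (f b)) = 0)).resolve_right
        (sub_pos.mpr vb).ne'
    have z3 : cr (f a) (f b) (f c) = 0 :=
      (mul_eq_zero.mp (by linarith : cr (f a) (f b) (f c) * (lin v (f c) - lin v (f p)) = 0)).resolve_right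
        (sub_pos.mpr vp).ne'
    linarith

/-- The barycentric coordinates of the seen point. -/
lemma lin_barycentric (w a b p e : ℂ) :
    cr p b e * (lin w a - lin w p) + cr a p e * (lin w b - lin w p) +
      cr a b p * (lin w e - lin w p) = 0 := by
  simp only [cr, lin]; ring

/-- If a hull omits the seen point `p` but meets the half-open triangle below it, it contains no
core point. -/
lemma Sees.no_core_in_hull {f : ι → ℂ} (hf : Function.Injective f) (hg : Gen f) {a b p : ι}
    (hab : HullEdge f a b) (hp : p ∈ core f) (hs : Sees f a b p) {σ τ : ℝ} (hσ : 0 < σ)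
    (hτ : 0 < τ) {y : ℂ} (hy : y = f p + σ • (f a - f p) + τ • (f b - f p))
    {A : Finset ι} (hpA : f p ∉ hull f A) (hyA : y ∈ hull f A) {e : ι} (he : e ∈ core f)
    (hep : e ≠ p) : f e ∉ hull f A := by
  intro heA
  obtain ⟨w, hw⟩ := exists_lin_lt hpA
  have hwy := lin_lt_of_mem_hull hw hyA
  have hwe := lin_lt_of_mem_hull hw heA
  have hD := hab.core_pos hf hp
  obtain ⟨s1, s2⟩ := hs e he hep
  have hbar := lin_barycentric w (f a) (f b) (f p) (f e)
  have hly : lin w y - lin w (f p) = σ * (lin w (f a) - lin w (f p)) +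
      τ * (lin w (f b) - lin w (f p)) := by
    rw [hy]
    simp only [lin, Complex.add_re, Complex.add_im, Complex.real_smul, Complex.mul_re,
      Complex.mul_im, Complex.sub_re, Complex.sub_im, Complex.ofReal_re, Complex.ofReal_im]
    ring
  have hcy : ∀ c, cr (f p) y c = σ * cr (f p) (f a) c - τ * cr (f p) c (f b) := by
    intro c
    rw [hy]
    simp only [cr, Complex.add_re, Complex.add_im, Complex.real_smul, Complex.mul_re,
      Complex.mul_im, Complex.sub_re, Complex.sub_im, Complex.ofReal_re, Complex.ofReal_im]
    ring
  have hlc : ∀ c, cr (f a) (f b) (f p) * (lin w c - lin w (f p)) =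
      cr (f p) c (f b) * (lin w (f a) - lin w (f p)) +
        cr (f p) (f a) c * (lin w (f b) - lin w (f p)) := by
    intro c
    simp only [cr, lin]; ring
  set α := lin w (f a) - lin w (f p) with hα
  set β := lin w (f b) - lin w (f p) with hβ
  have hsum : σ * α + τ * β < 0 := by linarith
  -- Since `p` is a positive combination of `a`, `b`, `e`, and `e` is below `p` with respect to `w`,
  -- one of `a`, `b` is above `p`. A generator on the same side of the line `p y` as that endpoint,
  -- but below `p`, is forced into the cone at `p` over the edge, which `Sees.triangle_empty`
  -- forbids.
  have hpt : ∃ c ∈ A, c ≠ a ∧ c ≠ b ∧ 0 ≤ cr (f p) (f c) (f b) ∧ 0 ≤ cr (f p) (f a) (f c) := by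
    rcases lt_or_ge 0 β with hb | hb
    · obtain ⟨c, hc, hcc⟩ : ∃ c ∈ A, 0 ≤ cr (f p) y (f c) := by
        by_contra! hcon
        have := cr_pos_of_mem_hull (a := y) (b := f p) (fun j hj => by
          have := hcon j hj
          rw [cr_swap]; linarith) hyA
        rw [cr_self_left] at this
        exact lt_irrefl _ this
      have hwc := hw c hc
      have hl := hlc (f c)
      rw [hcy] at hcc
      set s := cr (f p) (f c) (f b)
      set u := cr (f p) (f a) (f c)
      have hneg : s * α + u * β < 0 := by
        rw [← hl]; exact mul_neg_of_pos_of_neg hD (by linarith)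
      have hs0 : 0 ≤ s := by
        by_contra! hs0
        nlinarith [mul_pos_of_neg_of_neg hs0 hsum, mul_nonneg hcc hb.le]
      have hu0 : 0 ≤ u := by
        by_contra! hu0
        nlinarith [mul_nonneg hτ.le hs0, mul_neg_of_pos_of_neg hσ hu0]
      refine ⟨c, hc, ?_, ?_, hs0, hu0⟩
      · rintro rfl
        have e1 : u = 0 := cr_self_right _ _
        have e2 : s = cr (f c) (f b) (f p) := cr_rotate _ _ _
        rw [e1, e2] at hcc
        nlinarith
      · rintro rfl
        linarith
    · have ha : 0 < α := by
        by_contra! ha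
        nlinarith [mul_nonneg s2.le (neg_nonneg.mpr ha), mul_nonneg s1.le (neg_nonneg.mpr hb),
          mul_neg_of_pos_of_neg hD (sub_neg.mpr hwe)]
      obtain ⟨c, hc, hcc⟩ : ∃ c ∈ A, cr (f p) y (f c) ≤ 0 := by
        by_contra! hcon
        have := cr_pos_of_mem_hull hcon hyA
        rw [cr_self_right] at this
        exact lt_irrefl _ this
      have hwc := hw c hc
      have hl := hlc (f c)
      rw [hcy] at hcc
      set s := cr (f p) (f c) (f b)
      set u := cr (f p) (f a) (f c)
      have hneg : s * α + u * β < 0 := by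
        rw [← hl]; exact mul_neg_of_pos_of_neg hD (by linarith)
      have hu0 : 0 ≤ u := by
        by_contra! hu0
        nlinarith [mul_pos_of_neg_of_neg hu0 hsum, mul_nonneg (neg_nonneg.mpr hcc) ha.le]
      have hs0 : 0 ≤ s := by
        by_contra! hs0
        nlinarith [mul_nonneg hσ.le hu0, mul_neg_of_pos_of_neg hτ hs0]
      refine ⟨c, hc, ?_, ?_, hs0, hu0⟩
      · rintro rfl
        linarith
      · rintro rfl
        have e1 : s = 0 := cr_self_right _ _
        have e2 : u = cr (f a) (f c) (f p) := cr_rotate _ _ _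
        rw [e1, e2] at hcc
        nlinarith
  obtain ⟨c, hc, hca, hcb, h1, h2⟩ := hpt
  have hcp : c ≠ p := by
    rintro rfl
    exact lt_irrefl _ (hw c hc)
  exact absurd (Sees.triangle_empty hf hg hab hp hs hca hcb hcp h1) (not_lt.mpr h2)

/-- If the hull of `A ∪ {a, b}` contains a further core point, then it contains the seen point
`p` even when `p` is removed from its generators. -/
lemma Sees.mem_hull_erase {f : ι → ℂ} (hf : Function.Injective f) {a b p : ι}
    (hab : HullEdge f a b) (hp : p ∈ core f) (hs : Sees f a b p) {A : Finset ι} {e : ι}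
    (he : e ∈ core f) (hep : e ≠ p) (heA : f e ∈ hull f (insert a (insert b A))) :
    f p ∈ hull f (insert a (insert b (A.erase p))) := by
  by_contra hout
  obtain ⟨w, hw⟩ := exists_lin_lt hout
  have wa := hw a (by simp)
  have wb := hw b (by simp)
  have hle : ∀ j ∈ insert a (insert b A), lin w (f j) ≤ lin w (f p) := by
    intro j hj
    by_cases hjp : j = p
    · rw [hjp]
    · exact (hw j (by simp only [Finset.mem_insert, Finset.mem_erase] at hj ⊢; tauto)).le
  have we := lin_le_of_mem_hull hle heA
  have hD := hab.core_pos hf hp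
  obtain ⟨s1, s2⟩ := hs e he hep
  -- `p` is a strictly positive combination of `a`, `b`, `e`, so `lin w` cannot be strictly smaller
  -- at `a` and `b` without being larger at `e`.
  have hbar := lin_barycentric w (f a) (f b) (f p) (f e)
  have t1 := mul_neg_of_pos_of_neg s2 (sub_neg.mpr wa)
  have t2 := mul_neg_of_pos_of_neg s1 (sub_neg.mpr wb)
  have t3 := mul_nonpos_of_nonneg_of_nonpos hD.le (sub_nonpos.mpr we)
  linarith

omit [Fintype ι] in
lemma hull_update_of_notMem {f : ι → ℂ} {A : Finset ι} {p : ι} (hp : p ∉ A) (y : ℂ) :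
    hull (Function.update f p y) A = hull f A :=
  hull_congr fun j hj => Function.update_of_ne (fun h : j = p => hp (h ▸ hj)) _ _

omit [DecidableEq ι] in
lemma mem_core_of_mem_interior {f : ι → ℂ} {A : Finset ι} {j : ι}
    (h : f j ∈ interior (hull f A)) : j ∈ core f :=
  mem_core.mpr (interior_mono (hull_mono f (Finset.subset_univ _)) h)

/-- The seen point can be moved towards the hull edge. -/
theorem Sees.bdd_update {k : ℕ} {f : ι → ℂ} (hf : Function.Injective f) (hg : Gen f)
    (hb : Bdd k f) (hk : 1 ≤ k) {a b p : ι}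
    (hab : HullEdge f a b) (hp : p ∈ core f) (hs : Sees f a b p) {σ τ : ℝ} (hσ : 0 < σ)
    (hτ : 0 < τ) (hστ : σ + τ ≤ 1) {y : ℂ}
    (hy : y = f p + σ • (f a - f p) + τ • (f b - f p)) :
    Bdd k (Function.update f p y) := by
  intro A hne
  have hother : ∀ j, j ≠ p → Function.update f p y j = f j :=
    fun j hj => Function.update_of_ne hj _ _
  have hpa : p ≠ a := ne_of_mem_of_notMem_core hp (hab.left_notMem hf)
  have hpb : p ≠ b := ne_of_mem_of_notMem_core hp (hab.right_notMem hf)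
  -- If `p` is a generator, exchange it for `a` and `b`: this costs at most one more generator, and
  -- `p` itself becomes an additional interior point, so the bound for the new set gives the old
  -- one. If `p` is not a generator, the hull is unchanged and only `p` can enter it.
  by_cases hpA : p ∈ A
  · set C := insert a (insert b A) with hC
    set B := insert a (insert b (A.erase p)) with hB
    have hyC : y ∈ hull f C := by
      have h1 : f p ∈ hull f C := mem_hull f (by simp [hC, hpA])
      have h2 : f a ∈ hull f C := mem_hull f (by simp [hC])
      have h3 : f b ∈ hull f C := mem_hull f (by simp [hC])
      have h4 := (convex_hull f C).sum_mem (t := Finset.univ) (w := ![1 - σ - τ, σ, τ])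
        (z := ![f p, f a, f b]) (by
          intro i _; fin_cases i <;> simp <;> linarith) (by simp [Fin.sum_univ_three]; ring) (by
          intro i _; fin_cases i <;> simp [h1, h2, h3])
      convert h4 using 1
      rw [hy]
      simp only [Fin.sum_univ_three, Matrix.cons_val_zero, Matrix.cons_val_one, Matrix.cons_val]
      module
    have hsubC : hull (Function.update f p y) A ⊆ hull f C := by
      apply hull_subset (convex_hull f C)
      intro j hj
      by_cases hjp : j = p
      · rw [hjp, Function.update_self]; exact hyC
      · rw [hother j hjp]; exact mem_hull f (by simp [hC, hj])
    have hin : ∀ j ∈ inn (Function.update f p y) A, j ∉ A ∧ j ≠ p ∧ f j ∈ interior (hull f C) := by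
      intro j hj
      rw [mem_inn] at hj
      have hjp : j ≠ p := fun h => hj.1 (h ▸ hpA)
      refine ⟨hj.1, hjp, ?_⟩
      have := hj.2
      rw [hother j hjp] at this
      exact interior_mono hsubC this
    obtain ⟨e, he⟩ := hne
    obtain ⟨_, hep, heC⟩ := hin e he
    have hpB := Sees.mem_hull_erase hf hab hp hs (mem_core_of_mem_interior heC) hep
      (interior_subset heC)
    have hCB : hull f C ⊆ hull f B := by
      apply hull_subset (convex_hull f B)
      intro j hj
      by_cases hjp : j = p
      · rw [hjp]; exact hpB
      · exact mem_hull f (by simp only [hC, hB, Finset.mem_insert, Finset.mem_erase] at hj ⊢; tauto)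
    have hpnB : p ∉ B := by simp [hB, hpa, hpb]
    have hsub : insert p (inn (Function.update f p y) A) ⊆ inn f B := by
      intro j hj
      rw [mem_inn]
      rcases Finset.mem_insert.mp hj with rfl | hj
      · exact ⟨hpnB, hg.mem_interior hf hpnB hpB⟩
      · obtain ⟨h1, h2, h3⟩ := hin j hj
        have hc := mem_core_of_mem_interior h3
        refine ⟨?_, interior_mono hCB h3⟩
        have ha := ne_of_mem_of_notMem_core hc (hab.left_notMem hf)
        have hb := ne_of_mem_of_notMem_core hc (hab.right_notMem hf)
        simp [hB, ha, hb, h1]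
    have h1 := hb B ⟨p, hsub (by simp)⟩
    have h2 := Finset.card_le_card hsub
    rw [Finset.card_insert_of_notMem (fun h => (hin p h).2.1 rfl)] at h2
    have h3 : B.card ≤ A.card + 1 := by
      have e1 := Finset.card_insert_le a (insert b (A.erase p))
      have e2 := Finset.card_insert_le b (A.erase p)
      have e3 := Finset.card_erase_add_one hpA
      rw [← hB] at e1
      omega
    omega
  · have hhull := hull_update_of_notMem (f := f) hpA y
    by_cases hpin : p ∈ inn (Function.update f p y) A ∧ p ∉ inn f A
    · obtain ⟨h1, h2⟩ := hpin
      rw [mem_inn, Function.update_self, hhull] at h1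
      have hpout : f p ∉ hull f A := fun h =>
        h2 (mem_inn.mpr ⟨hpA, hg.mem_interior hf hpA h⟩)
      have hsub : inn (Function.update f p y) A ⊆ {p} := by
        intro j hj
        rw [Finset.mem_singleton]
        by_contra hjp
        rw [mem_inn, hother j hjp, hhull] at hj
        exact Sees.no_core_in_hull hf hg hab hp hs hσ hτ hy hpout (interior_subset h1.2)
          (mem_core_of_mem_interior hj.2) hjp (interior_subset hj.2)
      have h3 := Finset.card_le_card hsub
      -- Here `p` is the only interior point, and `k ≥ 1` admits one for any three or more
      -- generators.
      have h4 := three_le_card h1.2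
      simp only [Finset.card_singleton] at h3
      omega
    · have hsub : inn (Function.update f p y) A ⊆ inn f A := by
        intro j hj
        by_cases hjp : j = p
        · subst hjp
          by_contra hcon
          exact hpin ⟨hj, hcon⟩
        · rw [mem_inn, hother j hjp, hhull] at hj
          exact mem_inn.mpr hj
      have h1 := hb A (hne.mono hsub)
      have h2 := Finset.card_le_card hsub
      omega

end Move

/-! ### Carrying a core point across a hull edge along a generic segment. -/

section Path

variable {ι : Type*} [Fintype ι] [DecidableEq ι]

/-- The points other than `f p` that lie on two lines spanned by the family without `p`. -/
def crossings (f : ι → ℂ) (p : ι) : Set ℂ :=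
  {z | ∃ q r q' r', q ≠ p ∧ r ≠ p ∧ q' ≠ p ∧ r' ≠ p ∧ q ≠ r ∧ q' ≠ r' ∧
    ({q, r} : Finset ι) ≠ {q', r'} ∧ cr (f q) (f r) z = 0 ∧ cr (f q') (f r') z = 0}

lemma cr_eq_zero_of_two {a b c z z' : ℂ} (hz : z ≠ z') (h1 : cr a b z = 0) (h2 : cr a b z' = 0)
    (h3 : cr z z' c = 0) : cr a b c = 0 := by
  have e1 : (z'.re - z.re) * cr a b c = 0 := by
    unfold cr at *
    linear_combination (c.re - z.re) * h2 - (c.re - z'.re) * h1 + (b.re - a.re) * h3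
  have e2 : (z'.im - z.im) * cr a b c = 0 := by
    unfold cr at *
    linear_combination (c.im - z.im) * h2 - (c.im - z'.im) * h1 + (b.im - a.im) * h3
  by_contra hc
  apply hz
  have e1' := (mul_eq_zero.mp e1).resolve_right hc
  have e2' := (mul_eq_zero.mp e2).resolve_right hc
  apply Complex.ext <;> linarith

lemma cr_pts_eq_zero {a b z z' w : ℂ} (hab : a ≠ b) (h1 : cr a b z = 0) (h2 : cr a b z' = 0)
    (h3 : cr a b w = 0) : cr z z' w = 0 := by
  have e1 : (b.re - a.re) * cr z z' w = 0 := by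
    unfold cr at *
    linear_combination (z'.re - z.re) * h3 - (z'.re - w.re) * h1 + (z.re - w.re) * h2
  have e2 : (b.im - a.im) * cr z z' w = 0 := by
    unfold cr at *
    linear_combination (z'.im - z.im) * h3 - (z'.im - w.im) * h1 + (z.im - w.im) * h2
  by_contra hc
  apply hab
  have e1' := (mul_eq_zero.mp e1).resolve_right hc
  have e2' := (mul_eq_zero.mp e2).resolve_right hc
  apply Complex.ext <;> linarith

/-- In general position different pairs span different lines, two such lines share at most one
point, and there are finitely many pairs. -/
lemma finite_crossings {f : ι → ℂ} (hf : Function.Injective f) (hg : Gen f) (p : ι) :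
    (crossings f p).Finite := by
  let L : ι × ι × ι × ι → Set ℂ := fun t =>
    {z | t.1 ≠ t.2.1 ∧ t.2.2.1 ≠ t.2.2.2 ∧ ({t.1, t.2.1} : Finset ι) ≠ {t.2.2.1, t.2.2.2} ∧
      cr (f t.1) (f t.2.1) z = 0 ∧ cr (f t.2.2.1) (f t.2.2.2) z = 0}
  have hL : ∀ t, (L t).Finite := by
    rintro ⟨q, r, q', r'⟩
    apply Set.Subsingleton.finite
    rintro z ⟨h1, h2, h3, h4, h5⟩ z' ⟨_, _, _, h4', h5'⟩
    dsimp only at *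
    by_contra hz
    have hq' : cr (f q) (f r) (f q') = 0 :=
      cr_eq_zero_of_two hz h4 h4' (cr_pts_eq_zero (hf.ne h2) h5 h5' (cr_self_left _ _))
    have hr' : cr (f q) (f r) (f r') = 0 :=
      cr_eq_zero_of_two hz h4 h4' (cr_pts_eq_zero (hf.ne h2) h5 h5' (cr_self_right _ _))
    have m1 : q' = q ∨ q' = r := by
      by_contra! hcon
      exact hg q r q' h1 hcon.1.symm hcon.2.symm hq'
    have m2 : r' = q ∨ r' = r := by
      by_contra! hcon
      exact hg q r r' h1 hcon.1.symm hcon.2.symm hr'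
    apply h3
    rcases m1 with rfl | rfl <;> rcases m2 with rfl | rfl
    · exact absurd rfl h2
    · rfl
    · exact Finset.pair_comm _ _
    · exact absurd rfl h2
  apply (Set.finite_iUnion hL).subset
  rintro z ⟨q, r, q', r', _, _, _, _, h1, h2, h3, h4, h5⟩
  exact Set.mem_iUnion.mpr ⟨(q, r, q', r'), h1, h2, h3, h4, h5⟩

omit [Fintype ι] in
lemma ne_of_mem_crossings {f : ι → ℂ} (hg : Gen f) {p : ι} {z : ℂ}
    (hz : z ∈ crossings f p) : z ≠ f p := by
  obtain ⟨q, r, _, _, h1, h2, _, _, h3, _, _, h4, _⟩ := hz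
  rintro rfl
  exact hg q r p h3 h1 h2 h4

lemma cr_affine_right (a b u v : ℂ) (t : ℝ) :
    cr a b (u + t • (v - u)) = (1 - t) * cr a b u + t * cr a b v := by
  simp only [cr, Complex.add_re, Complex.add_im, Complex.real_smul, Complex.mul_re,
      Complex.mul_im, Complex.sub_re, Complex.sub_im, Complex.ofReal_re, Complex.ofReal_im]
  ring

/-- There is a point of the open segment `a b` whose line to `p` avoids all crossings. -/
lemma exists_generic_target {f : ι → ℂ} (hf : Function.Injective f) (hg : Gen f) {a b p : ι}
    (hpos : 0 < cr (f a) (f b) (f p)) :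
    ∃ s : ℝ, 0 < s ∧ s < 1 ∧ ∀ z ∈ crossings f p, cr (f p) z (f a + s • (f b - f a)) ≠ 0 := by
  let S : ℂ → Set ℝ := fun z => {s | z ≠ f p ∧ cr (f p) z (f a + s • (f b - f a)) = 0}
  -- Two parameters for the same `z` would put both `a` and `b`, hence the whole line `a b`, on the
  -- line `p z`; but `p` is not on it.
  have hS : ∀ z, (S z).Finite := by
    intro z
    apply Set.Subsingleton.finite
    rintro s ⟨h1, h2⟩ s' ⟨_, h2'⟩
    by_contra hne
    have hss : s - s' ≠ 0 := sub_ne_zero.mpr hne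
    rw [cr_affine_right] at h2 h2'
    have ea : cr (f p) z (f a) = 0 := by
      have : (s - s') * cr (f p) z (f a) = 0 := by linear_combination s * h2' - s' * h2
      exact (mul_eq_zero.mp this).resolve_left hss
    have eb : cr (f p) z (f b) = 0 := by
      have : (s - s') * cr (f p) z (f b) = 0 := by
        linear_combination (1 - s') * h2 - (1 - s) * h2'
      exact (mul_eq_zero.mp this).resolve_left hss
    have := cr_pts_eq_zero h1.symm ea eb (cr_self_left _ _)
    linarith
  have hfin : (⋃ z ∈ crossings f p, S z).Finite :=
    (finite_crossings hf hg p).biUnion fun z _ => hS z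
  obtain ⟨s, hs, hsn⟩ := (Set.Ioo_infinite (zero_lt_one' ℝ)).exists_notMem_finite hfin
  refine ⟨s, hs.1, hs.2, fun z hz h0 => hsn ?_⟩
  simp only [Set.mem_iUnion]
  exact ⟨z, hz, ne_of_mem_crossings hg hz, h0⟩

omit [Fintype ι] in
/-- Collinear triples after moving one point of a generic family involve that point. -/
lemma collinear_update {f : ι → ℂ} (hg : Gen f) {p : ι} {y : ℂ} {i j l : ι} (hij : i ≠ j)
    (hil : i ≠ l) (hjl : j ≠ l) (h : cr (Function.update f p y i) (Function.update f p y j)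
      (Function.update f p y l) = 0) :
    ∃ q r, q ≠ p ∧ r ≠ p ∧ q ≠ r ∧ ({i, j, l} : Finset ι) = {p, q, r} ∧
      cr (f q) (f r) y = 0 := by
  by_cases hi : i = p
  · subst hi
    rw [Function.update_self, Function.update_of_ne hij.symm, Function.update_of_ne hil.symm] at h
    exact ⟨j, l, hij.symm, hil.symm, hjl, rfl, by rw [← h, ← cr_rotate]⟩
  · by_cases hj : j = p
    · subst hj
      rw [Function.update_self, Function.update_of_ne hij, Function.update_of_ne hjl.symm] at h
      refine ⟨l, i, hjl.symm, hij, hil.symm, ?_, by rw [← h, cr_rotate]⟩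
      ext x; simp only [Finset.mem_insert, Finset.mem_singleton]; tauto
    · by_cases hl : l = p
      · subst hl
        rw [Function.update_self, Function.update_of_ne hil, Function.update_of_ne hjl] at h
        refine ⟨i, j, hil, hjl, hij, ?_, h⟩
        ext x; simp only [Finset.mem_insert, Finset.mem_singleton]; tauto
      · rw [Function.update_of_ne hi, Function.update_of_ne hj, Function.update_of_ne hl] at h
        exact absurd h (hg i j l hij hil hjl)

-- After the move a collinear triple consists of `p` and a pair whose line passes through `y`; two
-- different such pairs would make `y` a crossing.
omit [Fintype ι] in
lemma uniqueCol_update {f : ι → ℂ} (hg : Gen f) {p : ι} {y : ℂ} (hy : y ∉ crossings f p) :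
    UniqueCol (Function.update f p y) := by
  intro i j l i' j' l' a1 a2 a3 b1 b2 b3 h h'
  obtain ⟨q, r, c1, c2, c3, e, c4⟩ := collinear_update hg a1 a2 a3 h
  obtain ⟨q', r', d1, d2, d3, e', d4⟩ := collinear_update hg b1 b2 b3 h'
  rw [e, e']
  by_contra hne
  refine hy ⟨q, r, q', r', c1, c2, d1, d2, c3, d3, fun h => hne ?_, c4, d4⟩
  rw [h]

omit [Fintype ι] in
lemma injective_update {f : ι → ℂ} (hf : Function.Injective f) {p : ι} {y : ℂ}
    (hy : ∀ j, j ≠ p → f j ≠ y) : Function.Injective (Function.update f p y) := by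
  intro i j hij
  by_cases hi : i = p
  · by_cases hj : j = p
    · rw [hi, hj]
    · subst hi
      rw [Function.update_self, Function.update_of_ne hj] at hij
      exact absurd hij.symm (hy j hj)
  · by_cases hj : j = p
    · subst hj
      rw [Function.update_self, Function.update_of_ne hi] at hij
      exact absurd hij (hy i hi)
    · rw [Function.update_of_ne hi, Function.update_of_ne hj] at hij
      exact hf hij

/-- Moving one point along a line, the family is generic except at finitely many times. -/
lemma finite_not_gen_update {f : ι → ℂ} (hg : Gen f) (p : ι) (x : ℂ) :
    {t : ℝ | ¬ Gen (Function.update f p (f p + t • (x - f p)))}.Finite := by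
  let S : ι × ι → Set ℝ := fun u => {t | u.1 ≠ p ∧ u.2 ≠ p ∧ u.1 ≠ u.2 ∧
    cr (f u.1) (f u.2) (f p + t • (x - f p)) = 0}
  have hS : ∀ u, (S u).Finite := by
    rintro ⟨q, r⟩
    apply Set.Subsingleton.finite
    rintro t ⟨h1, h2, h3, h4⟩ t' ⟨_, _, _, h4'⟩
    dsimp only at *
    rw [cr_affine_right] at h4 h4'
    have h0 := hg q r p h3 h1 h2
    by_contra hne
    apply h0
    have : (t - t') * cr (f q) (f r) (f p) = 0 := by linear_combination t * h4' - t' * h4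
    exact (mul_eq_zero.mp this).resolve_left (sub_ne_zero.mpr hne)
  apply (Set.finite_iUnion hS).subset
  intro t ht
  simp only [Set.mem_ofPred_eq, Gen] at ht
  push Not at ht
  obtain ⟨i, j, l, h1, h2, h3, h4⟩ := ht
  obtain ⟨q, r, c1, c2, c3, _, c4⟩ := collinear_update hg h1 h2 h3 h4
  exact Set.mem_iUnion.mpr ⟨(q, r), c1, c2, c3, c4⟩

/-- A core point can be moved out of the hull along a segment. -/
theorem exists_move {k : ℕ} {f : ι → ℂ} (hf : Function.Injective f) (hg : Gen f) (hb : Bdd k f)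
    (hk : 1 ≤ k) (hk2 : k ≤ 2) (hne : (core f).Nonempty) :
    ∃ (p : ι) (v : ℂ) (T : ℝ), 0 < T ∧
      (∀ t ∈ Set.Icc 0 T, Function.Injective (Function.update f p (f p + t • v)) ∧
        UniqueCol (Function.update f p (f p + t • v)) ∧
        Bdd k (Function.update f p (f p + t • v))) ∧
      Gen (Function.update f p (f p + T • v)) ∧
      (core (Function.update f p (f p + T • v))).card < (core f).card := by
  obtain ⟨a, b, p, hab, hp, hs⟩ := exists_sees hf hg hb hk2 hne
  have hD := hab.core_pos hf hp
  obtain ⟨s, hs0, hs1, hsz⟩ := exists_generic_target hf hg hD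
  set x := f a + s • (f b - f a) with hx
  have hpa : p ≠ a := ne_of_mem_of_notMem_core hp (hab.left_notMem hf)
  have hpb : p ≠ b := ne_of_mem_of_notMem_core hp (hab.right_notMem hf)
  set F : ℝ → ι → ℂ := fun t => Function.update f p (f p + t • (x - f p)) with hF
  have hFp : ∀ t, F t p = f p + t • (x - f p) := fun t => Function.update_self _ _ _
  have hFj : ∀ t j, j ≠ p → F t j = f j := fun t j hj => Function.update_of_ne hj _ _
  have hF1 : F 1 p = x := by rw [hFp, one_smul]; ring
  have hFcont : ∀ j, Continuous fun t => F t j := by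
    intro j
    by_cases hj : j = p
    · subst hj
      simp only [hFp]
      fun_prop
    · simp only [hFj _ j hj]
      fun_prop
  have hline : ∀ t : ℝ, cr (f p) (f p + t • (x - f p)) x = 0 := by
    intro t
    rw [cr_swap_right, cr_affine_right, cr_self_left, cr_self_right]; ring
  have hcross : ∀ t : ℝ, f p + t • (x - f p) ∉ crossings f p := fun t ht => hsz _ ht (hline t)
  have hxa : cr (f p) (f a) x = s * cr (f a) (f b) (f p) := by
    rw [hx, cr_affine_right, cr_self_right, cr_rotate (f p)]; ring
  have hxb : cr (f p) (f b) x = -((1 - s) * cr (f a) (f b) (f p)) := by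
    rw [hx, cr_affine_right, cr_self_right, cr_rotate (f a) (f b) (f p), cr_swap_right (f b)]
    rw [cr_rotate (f p) (f b) (f a)]
    have := cr_swap_right (f b) (f a) (f p)
    linarith
  have hinj : ∀ t, Function.Injective (F t) := by
    intro t
    apply injective_update hf
    intro j hj hjy
    have hl := hline t
    rw [← hjy] at hl
    by_cases hja : j = a
    · rw [hja, hxa] at hl
      exact (mul_pos hs0 hD).ne' hl
    · by_cases hjb : j = b
      · rw [hjb, hxb] at hl
        have := mul_pos (sub_pos.mpr hs1) hD
        linarith
      -- A collision with `f j` would be a crossing of the lines `j a` and `j b`.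
      · apply hcross t
        rw [← hjy]
        refine ⟨j, a, j, b, hj, hpa.symm, hj, hpb.symm, hja, hjb, fun h => ?_, cr_self_left _ _,
          cr_self_left _ _⟩
        have : a ∈ ({j, b} : Finset ι) := by rw [← h]; simp
        simp only [Finset.mem_insert, Finset.mem_singleton] at this
        rcases this with h | h
        · exact hja h.symm
        · exact hab.1 h
  have hbdd1 : ∀ t, 0 ≤ t → t ≤ 1 → Bdd k (F t) := by
    intro t h0 h1
    rcases h0.eq_or_lt with rfl | h0
    · have : F 0 = f := by
        simp only [hF, zero_smul, add_zero, Function.update_eq_self]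
      rw [this]; exact hb
    · refine Sees.bdd_update hf hg hb hk hab hp hs (σ := t * (1 - s)) (τ := t * s)
        (mul_pos h0 (by linarith)) (mul_pos h0 hs0) (by nlinarith) ?_
      rw [hx]
      module
  -- points outside of a hull at time `1` stay outside for a while
  have hopen : ∀ᶠ t in 𝓝 (1 : ℝ), ∀ (A : Finset ι) (e : ι), F 1 e ∉ hull (F 1) A →
      F t e ∉ hull (F t) A := by
    rw [eventually_all]
    intro A
    rw [eventually_all]
    intro e
    by_cases he : F 1 e ∈ hull (F 1) A
    · exact Eventually.of_forall fun t h => absurd he h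
    · filter_upwards [eventually_notMem_hull (fun j => (hFcont j).continuousAt) he] with t ht _
      exact ht
  obtain ⟨ε, hε, hball⟩ := Metric.eventually_nhds_iff.mp hopen
  -- At time `1` the moved point lies in the open segment `a b`, so every functional exposing an old
  -- vertex still exposes it.
  have hext : ∀ j, j ∉ core f → F 1 j ∉ hull (F 1) (Finset.univ.erase j) := by
    intro j hj hmem
    obtain ⟨w, hw⟩ := exists_lin_lt_of_notMem_core hf hg hj
    have hjp : j ≠ p := (ne_of_mem_of_notMem_core hp hj).symm
    have := lin_lt_of_mem_hull (w := w) (c := lin w (f j)) (fun i hi => by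
      by_cases hip : i = p
      · rw [hip, hF1, hx, lin_add, lin_smul]
        have hsub : lin w (f b - f a) = lin w (f b) - lin w (f a) := by
          simp only [lin, Complex.sub_re, Complex.sub_im]; ring
        rw [hsub]
        by_cases hja : j = a
        · subst hja
          have := hw b hab.1.symm
          nlinarith
        · have h1 := hw a (Ne.symm hja)
          by_cases hjb : j = b
          · subst hjb
            nlinarith
          · have h2 := hw b (Ne.symm hjb)
            nlinarith
      · rw [hFj _ i hip]
        exact hw i (Finset.ne_of_mem_erase hi)) hmem
    rw [hFj _ j hjp] at this
    exact lt_irrefl _ this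
  -- a point other than `p` and not generating a hull at time `1` is outside or interior
  have hint : ∀ A e, e ∉ A → e ≠ p → F 1 e ∈ hull (F 1) A →
      F 1 e ∈ interior (hull (F 1) A) := by
    intro A e heA hep hmem
    by_contra hn
    rcases mem_or_between hmem hn with ⟨l, hl, he⟩ | ⟨i, hi, l, hl, m, _, _, hil, he⟩
    · rw [hinj 1 he] at hl; exact heA hl
    · have hie : i ≠ e := fun h => heA (h ▸ hi)
      have hle : l ≠ e := fun h => heA (h ▸ hl)
      have hil' : i ≠ l := fun h => hil (by rw [h])
      have hcol : cr (F 1 i) (F 1 e) (F 1 l) = 0 := by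
        rw [he]; exact cr_comb_eq_zero _ _ _
      obtain ⟨q, r, c1, c2, c3, c4, c5⟩ := collinear_update hg hie hil' hle.symm hcol
      -- At time `1` the moved point is on the line `a b`; being no crossing, it lies on no other
      -- line of the family.
      have hqr : ({q, r} : Finset ι) = {a, b} := by
        by_contra hne
        apply hcross 1
        refine ⟨q, r, a, b, c1, c2, hpa.symm, hpb.symm, c3, hab.1, hne, c5, ?_⟩
        have : f p + (1 : ℝ) • (x - f p) = x := by rw [one_smul]; ring
        rw [this, hx, cr_affine_right, cr_self_left, cr_self_right]; ring
      have hmem' : e ∈ insert p ({q, r} : Finset ι) := by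
        have : e ∈ ({i, e, l} : Finset ι) := by simp
        rw [c4] at this
        exact this
      rw [hqr] at hmem'
      simp only [Finset.mem_insert, Finset.mem_singleton] at hmem'
      have hec : e ∉ core f := by
        rcases hmem' with h | h | h
        · exact absurd h hep
        · rw [h]; exact hab.left_notMem hf
        · rw [h]; exact hab.right_notMem hf
      exact hext e hec (hull_mono _ (fun j hj => by
        rw [Finset.mem_erase]
        exact ⟨fun h => heA (h ▸ hj), Finset.mem_univ _⟩) hmem)
  have hneg : ∀ t, 1 < t → cr (f a) (f b) (F t p) < 0 := by
    intro t ht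
    have hx0 : cr (f a) (f b) x = 0 := by
      rw [hx, cr_affine_right, cr_self_left, cr_self_right]; ring
    rw [hFp, cr_affine_right, hx0]
    nlinarith
  -- Just past the edge, `p` is outside every hull it does not generate, and any other interior
  -- point was already in the corresponding hull at time `1`, hence interior there by `hint`. So the
  -- bound at time `1` suffices.
  have hbdd2 : ∀ t, 1 < t → t < 1 + ε → Bdd k (F t) := by
    intro t h1 h2 A hne
    have ho := hball (y := t) (by rw [Real.dist_eq, abs_lt]; constructor <;> linarith)
    have hsub : inn (F t) A ⊆ inn (F 1) A := by
      intro j hj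
      rw [mem_inn] at hj ⊢
      refine ⟨hj.1, ?_⟩
      have hin1 : F 1 j ∈ hull (F 1) A := by
        by_contra hcon
        exact ho A j hcon (interior_subset hj.2)
      by_cases hjp : j = p
      · exfalso
        rw [hjp] at hj
        have := cr_nonneg_of_mem_hull (a := f a) (b := f b) (fun i hi => by
          rw [hFj t i (fun h => hj.1 (h ▸ hi))]
          exact hab.nonneg i) (interior_subset hj.2)
        have := hneg t h1
        linarith
      · exact hint A j hj.1 hjp hin1
    have h3 := hbdd1 1 zero_le_one le_rfl A (hne.mono hsub)
    have h4 := Finset.card_le_card hsub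
    omega
  obtain ⟨T, hT, hTg⟩ := (Set.Ioo_infinite (by linarith : (1 : ℝ) < 1 + ε)).exists_notMem_finite
    (finite_not_gen_update hg p x)
  simp only [Set.mem_ofPred_eq, not_not] at hTg
  refine ⟨p, x - f p, T, by linarith [hT.1], fun t ht => ⟨hinj t, uniqueCol_update hg (hcross t),
    ?_⟩, hTg, ?_⟩
  · rcases le_or_gt t 1 with h | h
    · exact hbdd1 t ht.1 h
    · exact hbdd2 t h (by linarith [ht.2, hT.2])
  -- The point `p` leaves the core, and by `hext` and openness no other point enters it.
  · apply Finset.card_lt_card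
    rw [Finset.ssubset_iff_of_subset]
    · refine ⟨p, hp, ?_⟩
      refine notMem_core_of_forall_le (w := -nrm (f a) (f b))
        (neg_ne_zero.mpr (nrm_ne_zero (hf.ne hab.1))) (fun i => ?_)
      change lin _ (F T i) ≤ lin _ (F T p)
      rw [lin_neg_left, lin_neg_left]
      have h1 := hneg T hT.1
      by_cases hip : i = p
      · rw [hip]
      · have h2 := hab.nonneg i
        rw [← hFj T i hip] at h2
        rw [cr_eq_lin] at h1 h2
        linarith
    · intro j hj
      by_contra hjc
      have ho := hball (y := T) (by
        rw [Real.dist_eq, abs_lt]; constructor <;> linarith [hT.1, hT.2])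
      have h1 := ho _ j (hext j hjc)
      obtain ⟨w, hw⟩ := exists_lin_lt h1
      have hw0 : w ≠ 0 := by
        rintro rfl
        have := hw p (by simp [ne_of_mem_of_notMem_core hp hjc])
        simp [lin] at this
      refine notMem_core_of_forall_le (f := F T) hw0 (fun i => ?_) hj
      by_cases hij : i = j
      · rw [hij]
      · exact (hw i (by simp [hij])).le

end Path

/-! ### Removing the collinear triple by moving its middle point. -/

section Perturb

variable {ι : Type*} [Fintype ι] [DecidableEq ι]

omit [Fintype ι] [DecidableEq ι] in
/-- One of three collinear points lies strictly between the other two. -/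
lemma exists_middle {f : ι → ℂ} (hf : Function.Injective f) {i j l : ι} (hij : i ≠ j)
    (hil : i ≠ l) (hjl : j ≠ l) (h : cr (f i) (f j) (f l) = 0) :
    ∃ q r s, q ≠ r ∧ q ≠ s ∧ r ≠ s ∧ ∃ m : ℝ, 0 < m ∧ m < 1 ∧ f r = (1 - m) • f q + m • f s := by
  have hw : ∀ q r s, q ≠ r → r ≠ s → Wbtw ℝ (f q) (f r) (f s) →
      ∃ m : ℝ, 0 < m ∧ m < 1 ∧ f r = (1 - m) • f q + m • f s := by
    rintro q r s hqr hrs ⟨m, ⟨h0, h1⟩, hm⟩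
    rw [AffineMap.lineMap_apply_module] at hm
    refine ⟨m, lt_of_le_of_ne h0 ?_, lt_of_le_of_ne h1 ?_, hm.symm⟩
    · rintro rfl
      apply hf.ne hqr
      rw [← hm]; simp
    · rintro rfl
      apply hf.ne hrs
      rw [← hm]; simp
  rcases ((collinear_iff_cr _ _ _ (hf.ne hij)).mpr h).wbtw_or_wbtw_or_wbtw with h | h | h
  · exact ⟨i, j, l, hij, hil, hjl, hw _ _ _ hij hjl h⟩
  · exact ⟨j, l, i, hjl, hij.symm, hil.symm, hw _ _ _ hjl hil.symm h⟩
  · exact ⟨l, i, j, hil.symm, hjl.symm, hij, hw _ _ _ hil.symm hij h⟩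

omit [Fintype ι] in
lemma cr_ne_zero_of_insert_eq {g : ι → ℂ} {i j l q r s : ι} (hij : i ≠ j) (hil : i ≠ l)
    (hjl : j ≠ l) (h : ({i, j, l} : Finset ι) = {q, r, s}) (hne : cr (g q) (g r) (g s) ≠ 0) :
    cr (g i) (g j) (g l) ≠ 0 := by
  have hi : i ∈ ({q, r, s} : Finset ι) := by rw [← h]; simp
  have hj : j ∈ ({q, r, s} : Finset ι) := by rw [← h]; simp
  have hl : l ∈ ({q, r, s} : Finset ι) := by rw [← h]; simp
  simp only [Finset.mem_insert, Finset.mem_singleton] at hi hj hl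
  intro h0
  apply hne
  unfold cr at *
  rcases hi with rfl | rfl | rfl <;> rcases hj with rfl | rfl | rfl <;>
    rcases hl with rfl | rfl | rfl <;>
    first
    | exact absurd rfl hij
    | exact absurd rfl hil
    | exact absurd rfl hjl
    | linarith

/-- `A` lies to the left of the line `q s`, contains `q` and `s` but not `r`, and its bound is
attained. -/
def Tight (k : ℕ) (f : ι → ℂ) (q r s : ι) (A : Finset ι) : Prop :=
  r ∉ A ∧ q ∈ A ∧ s ∈ A ∧ (∀ j ∈ A, 0 ≤ cr (f q) (f s) (f j)) ∧ (inn f A).Nonempty ∧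
    (inn f A).card + 3 = A.card + k

/-- The middle point of the collinear triple cannot be blocked on both sides. -/
lemma not_tight_both {k : ℕ} {f : ι → ℂ} (hf : Function.Injective f) (hb : Bdd k f) (hk : 1 ≤ k)
    {q r s : ι} (hqs : q ≠ s) {m : ℝ} (hm0 : 0 < m) (hm1 : m < 1)
    (hr : f r = (1 - m) • f q + m • f s) {A A' : Finset ι} (hA : Tight k f q r s A)
    (hA' : Tight k f s r q A') : False := by
  obtain ⟨hrA, hqA, hsA, hl, ⟨e, he⟩, hc⟩ := hA
  obtain ⟨hrA', hsA', hqA', hl', ⟨e', he'⟩, hc'⟩ := hA'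
  have pos : ∀ j ∈ inn f A, 0 < cr (f q) (f s) (f j) := fun j hj =>
    cr_pos_of_mem_interior (hf.ne hqs) hl (mem_inn.mp hj).2
  have pos' : ∀ j ∈ inn f A', 0 < cr (f s) (f q) (f j) := fun j hj =>
    cr_pos_of_mem_interior (hf.ne hqs.symm) hl' (mem_inn.mp hj).2
  have hswap : ∀ j, cr (f s) (f q) (f j) = -cr (f q) (f s) (f j) := fun j => cr_swap _ _ _
  have hr0 : cr (f q) (f s) (f r) = 0 := by
    rw [cr_swap_right, hr, cr_comb_eq_zero, neg_zero]
  -- A supporting line at `r` would contain both `q` and `s`, hence be the line `q s`; but `e` and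
  -- `e'` are interior points on opposite sides of it.
  have hrint : f r ∈ interior (hull f (A ∪ A')) := by
    by_contra hn
    obtain ⟨w, hw, hle⟩ := exists_lin_le hn
    have hq := hle q (Finset.mem_union_left _ hqA)
    have hs := hle s (Finset.mem_union_left _ hsA)
    have hre : lin w (f r) = (1 - m) * lin w (f q) + m * lin w (f s) := by
      rw [hr, lin_add, lin_smul, lin_smul]
    have hqe : lin w (f q) = lin w (f r) := by nlinarith
    have hse : lin w (f s) = lin w (f r) := by nlinarith
    have h1 : lin w (f e) < lin w (f r) :=
      lin_lt_of_mem_interior hw hle (interior_mono (hull_mono f Finset.subset_union_left)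
        (mem_inn.mp he).2)
    have h2 : lin w (f e') < lin w (f r) :=
      lin_lt_of_mem_interior hw hle (interior_mono (hull_mono f Finset.subset_union_right)
        (mem_inn.mp he').2)
    have p1 := pos e he
    have p2 := pos' e' he'
    rw [hswap] at p2
    -- both differences are the same multiple of the signed distance to the line
    have key : cr (f q) (f s) (f e') * (lin w (f e) - lin w (f q)) =
        cr (f q) (f s) (f e) * (lin w (f e') - lin w (f q)) +
        cr (f q) (f e') (f e) * (lin w (f q) - lin w (f s)) := by
      simp only [cr, lin]; ring
    rw [hqe, hse] at key
    have t1 := mul_pos_of_neg_of_neg (neg_pos.mp p2) (sub_neg.mpr h1)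
    have t2 := mul_neg_of_pos_of_neg p1 (sub_neg.mpr h2)
    linarith
  have hsub : insert r (inn f A ∪ inn f A') ⊆ inn f (A ∪ A') := by
    intro j hj
    rw [mem_inn]
    rcases Finset.mem_insert.mp hj with rfl | hj
    · exact ⟨by simp [hrA, hrA'], hrint⟩
    · rcases Finset.mem_union.mp hj with hj | hj
      · have hp := pos j hj
        rw [mem_inn] at hj
        refine ⟨?_, interior_mono (hull_mono f Finset.subset_union_left) hj.2⟩
        rw [Finset.mem_union]
        rintro (h | h)
        · exact hj.1 h
        · have := hl' j h
          rw [hswap] at this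
          linarith
      · have hp := pos' j hj
        rw [mem_inn] at hj
        refine ⟨?_, interior_mono (hull_mono f Finset.subset_union_right) hj.2⟩
        rw [Finset.mem_union]
        rintro (h | h)
        · have := hl j h
          rw [hswap] at hp
          linarith
        · exact hj.1 h
  have hdisj : Disjoint (inn f A) (inn f A') := by
    rw [Finset.disjoint_left]
    intro j h1 h2
    have p1 := pos j h1
    have p2 := pos' j h2
    rw [hswap] at p2
    linarith
  have hrn : r ∉ inn f A ∪ inn f A' := by
    rw [Finset.mem_union]
    rintro (h | h)
    · have := pos r h; linarith
    · have := pos' r h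
      rw [hswap] at this; linarith
  have h1 := Finset.card_le_card hsub
  rw [Finset.card_insert_of_notMem hrn, Finset.card_union_of_disjoint hdisj] at h1
  have h2 := hb (A ∪ A') ⟨r, hsub (by simp)⟩
  have h3 := Finset.card_union_add_card_inter A A'
  have h4 : 2 ≤ (A ∩ A').card := by
    rw [← Finset.card_pair hqs]
    apply Finset.card_le_card
    intro j hj
    simp only [Finset.mem_insert, Finset.mem_singleton] at hj
    rcases hj with rfl | rfl <;> simp [*]
  -- The union has `|inn f A| + |inn f A'| + 1` interior points but at most `|A| + |A'| - 2`
  -- generators. With both bounds attained, this would force `k ≤ 0`.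
  omega

/-- Moving the middle point of the only collinear triple to the left of the line is harmless
unless some tight set is on this side. -/
lemma eventually_bdd_update {k : ℕ} {f : ι → ℂ} (hf : Function.Injective f) (hu : UniqueCol f)
    (hb : Bdd k f) (hk : 1 ≤ k) {q r s : ι} (hqr : q ≠ r) (hqs : q ≠ s) (hrs : r ≠ s) {m : ℝ}
    (hm0 : 0 < m) (hm1 : m < 1) (hr : f r = (1 - m) • f q + m • f s)
    (hA : ∀ A, ¬ Tight k f q r s A) :
    ∀ᶠ t : ℝ in 𝓝[>] 0, Bdd k (Function.update f r (f r + t • nrm (f q) (f s))) := by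
  set ν := nrm (f q) (f s) with hν
  set F : ℝ → ι → ℂ := fun t => Function.update f r (f r + t • ν) with hF
  have hFr : ∀ t, F t r = f r + t • ν := fun t => Function.update_self _ _ _
  have hFj : ∀ t j, j ≠ r → F t j = f j := fun t j hj => Function.update_of_ne hj _ _
  have hF0 : F 0 = f := by simp only [hF, zero_smul, add_zero, Function.update_eq_self]
  have hFcont : ∀ j, Continuous fun t => F t j := by
    intro j
    by_cases hj : j = r
    · subst hj; simp only [hFr]; fun_prop
    · simp only [hFj _ j hj]; fun_prop
  have hr0 : cr (f q) (f s) (f r) = 0 := by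
    rw [cr_swap_right, hr, cr_comb_eq_zero, neg_zero]
  have hside : ∀ t, cr (f q) (f s) (F t r) = t * lin ν ν := by
    intro t
    rw [hFr, cr_eq_lin, lin_add, lin_smul]
    rw [cr_eq_lin] at hr0
    linarith
  have hνpos : 0 < lin ν ν := lin_self_pos (nrm_ne_zero (hf.ne hqs))
  have hopen : ∀ᶠ t in 𝓝 (0 : ℝ), ∀ (A : Finset ι) (e : ι), f e ∉ hull f A →
      F t e ∉ hull (F t) A := by
    rw [eventually_all]
    intro A
    rw [eventually_all]
    intro e
    by_cases he : f e ∈ hull f A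
    · exact Eventually.of_forall fun t h => absurd he h
    · filter_upwards [eventually_notMem_hull (F := F) (x := 0) (A := A) (e := e)
        (fun j => (hFcont j).continuousAt) (by rw [hF0]; exact he)] with t ht _
      exact ht
  -- A non-generator on the boundary of a hull is the middle of a collinear triple; uniqueness of
  -- the triple identifies it with `r` between `q` and `s`.
  have hmid : ∀ A e, e ∉ A → f e ∈ hull f A → f e ∉ interior (hull f A) →
      e = r ∧ q ∈ A ∧ s ∈ A := by
    intro A e heA hmem hn
    rcases mem_or_between hmem hn with ⟨l, hl, he⟩ | ⟨i, hi, l, hl, μ, hμ0, hμ1, hil, he⟩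
    · rw [hf he] at hl; exact absurd hl heA
    · have hie : i ≠ e := fun h => heA (h ▸ hi)
      have hle : l ≠ e := fun h => heA (h ▸ hl)
      have hil' : i ≠ l := fun h => hil (by rw [h])
      have hcol : cr (f i) (f e) (f l) = 0 := by rw [he]; exact cr_comb_eq_zero _ _ _
      have hcol' : cr (f q) (f r) (f s) = 0 := by rw [hr]; exact cr_comb_eq_zero _ _ _
      have hset := hu _ _ _ _ _ _ hie hil' hle.symm hqr hqs hrs hcol hcol'
      have hqm : q ∈ ({i, e, l} : Finset ι) := by rw [hset]; simp
      have hsm : s ∈ ({i, e, l} : Finset ι) := by rw [hset]; simp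
      have hem : e ∈ ({q, r, s} : Finset ι) := by rw [← hset]; simp
      have hrm : r ∈ ({i, e, l} : Finset ι) := by rw [hset]; simp
      simp only [Finset.mem_insert, Finset.mem_singleton] at hqm hsm hem hrm
      -- betweenness excludes that `e` is an end point of the triple
      have hend : ∀ q' s' : ι, q' ≠ r → q' ≠ s' → ∀ μ' : ℝ, 0 < μ' → μ' < 1 →
          f r = (1 - μ') • f q' + μ' • f s' → e = q' → (s' = i ∧ r = l ∨ s' = l ∧ r = i) →
          False := by
        rintro q' s' hq'r hq's μ' h0 h1 hr' rfl hcase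
        have hd : ∀ x y : ℝ, f e = (1 - x) • f r + x • f s' → f r = (1 - y) • f e + y • f s' →
            0 < x → 0 < y → x < 1 → y < 1 → False := by
          intro x y e1 e2 x0 y0 x1 y1
          apply hf.ne hq's
          rw [e2] at e1
          have hre := congrArg Complex.re e1
          have him := congrArg Complex.im e1
          simp only [Complex.add_re, Complex.add_im, Complex.real_smul, Complex.mul_re,
            Complex.mul_im, Complex.ofReal_re, Complex.ofReal_im] at hre him
          have hpos : 0 < x + y - x * y := by nlinarith
          apply Complex.ext
          · have : (x + y - x * y) * ((f e).re - (f s').re) = 0 := by linear_combination hre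
            have := (mul_eq_zero.mp this).resolve_left hpos.ne'
            linarith
          · have : (x + y - x * y) * ((f e).im - (f s').im) = 0 := by linear_combination him
            have := (mul_eq_zero.mp this).resolve_left hpos.ne'
            linarith
        rcases hcase with ⟨hi', hl'⟩ | ⟨hl', hi'⟩
        · rw [← hi', ← hl'] at he
          exact hd (1 - μ) μ' (by rw [he]; module) hr' (by linarith) h0 (by linarith) h1
        · rw [← hi', ← hl'] at he
          exact hd μ μ' he hr' hμ0 h0 hμ1 h1
      rcases hem with h | h | h
      · exfalso
        refine hend q s hqr hqs m hm0 hm1 hr h ?_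
        have hes : s ≠ e := fun h' => hqs (h.symm.trans h'.symm)
        have her : r ≠ e := fun h' => hqr (h.symm.trans h'.symm)
        rcases hsm with h2 | h2 | h2
        · rcases hrm with h3 | h3 | h3
          · exact absurd (h3.trans h2.symm) hrs
          · exact absurd h3 her
          · exact Or.inl ⟨h2, h3⟩
        · exact absurd h2 hes
        · rcases hrm with h3 | h3 | h3
          · exact Or.inr ⟨h2, h3⟩
          · exact absurd h3 her
          · exact absurd (h3.trans h2.symm) hrs
      · refine ⟨h, ?_, ?_⟩
        · rcases hqm with h2 | h2 | h2
          · rw [h2]; exact hi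
          · exact absurd (h2.trans h) hqr
          · rw [h2]; exact hl
        · rcases hsm with h2 | h2 | h2
          · rw [h2]; exact hi
          · exact absurd (h2.trans h).symm hrs
          · rw [h2]; exact hl
      · exfalso
        refine hend s q hrs.symm hqs.symm (1 - m) (by linarith) (by linarith)
          (by rw [hr]; module) h ?_
        have heq : q ≠ e := fun h' => hqs (h'.trans h)
        have her : r ≠ e := fun h' => hrs (h'.trans h)
        rcases hqm with h2 | h2 | h2
        · rcases hrm with h3 | h3 | h3
          · exact absurd (h2.trans h3.symm) hqr
          · exact absurd h3 her
          · exact Or.inl ⟨h2, h3⟩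
        · exact absurd h2 heq
        · rcases hrm with h3 | h3 | h3
          · exact Or.inr ⟨h2, h3⟩
          · exact absurd h3 her
          · exact absurd (h2.trans h3.symm) hqr
  filter_upwards [hopen.filter_mono nhdsWithin_le_nhds, self_mem_nhdsWithin] with t ho ht A hne
  have ht : 0 < t := ht
  change (inn (F t) A).card + 3 ≤ A.card + k
  have hother : ∀ j ∈ inn (F t) A, j ≠ r → j ∈ inn f A := by
    intro j hj hjr
    rw [mem_inn] at hj ⊢
    refine ⟨hj.1, ?_⟩
    have hin : f j ∈ hull f A := by
      by_contra hcon
      exact ho A j hcon (interior_subset hj.2)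
    by_contra hn
    exact hjr (hmid A j hj.1 hin hn).1
  by_cases hrin : r ∈ inn (F t) A ∧ r ∉ inn f A
  · obtain ⟨h1, h2⟩ := hrin
    rw [mem_inn] at h1
    have hn : f r ∉ interior (hull f A) := fun h => h2 (mem_inn.mpr ⟨h1.1, h⟩)
    have hin : f r ∈ hull f A := by
      by_contra hcon
      exact ho A r hcon (interior_subset h1.2)
    obtain ⟨_, hqA, hsA⟩ := hmid A r h1.1 hin hn
    have hhull : hull (F t) A = hull f A := hull_update_of_notMem h1.1 _
    rw [hhull] at h1
    obtain ⟨w, hw, hle⟩ := exists_lin_le hn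
    have hq := hle q hqA
    have hs := hle s hsA
    have hre : lin w (f r) = (1 - m) * lin w (f q) + m * lin w (f s) := by
      rw [hr, lin_add, lin_smul, lin_smul]
    have hqe : lin w (f q) = lin w (f r) := by nlinarith
    have hse : lin w (f s) = lin w (f r) := by nlinarith
    have hlt := lin_lt_of_mem_interior hw hle h1.2
    have hst := hside t
    have hpos : 0 < cr (f q) (f s) (F t r) := by rw [hst]; exact mul_pos ht hνpos
    -- The supporting functional at `r` is constant on the line `q s` and smaller at the moved
    -- point, so all generators lie on the side to which `r` moves.
    have hleft : ∀ j ∈ A, 0 ≤ cr (f q) (f s) (f j) := by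
      intro j hj
      have hj' := hle j hj
      have key : cr (f q) (f s) (F t r) * (lin w (f j) - lin w (f q)) =
          cr (f q) (f s) (f j) * (lin w (F t r) - lin w (f q)) +
          cr (f q) (F t r) (f j) * (lin w (f q) - lin w (f s)) := by
        simp only [cr, lin]; ring
      rw [hqe, hse] at key
      by_contra! hneg
      have t1 := mul_pos_of_neg_of_neg hneg (sub_neg.mpr hlt)
      have t2 := mul_nonpos_of_nonneg_of_nonpos hpos.le (sub_nonpos.mpr hj')
      linarith
    have hsub : inn (F t) A ⊆ insert r (inn f A) := by
      intro j hj
      by_cases hjr : j = r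
      · simp [hjr]
      · exact Finset.mem_insert_of_mem (hother j hj hjr)
    have hcard := (Finset.card_le_card hsub).trans (Finset.card_insert_le _ _)
    -- Only `r` is gained. From none, one point is allowed because `k ≥ 1`; otherwise `A` is not
    -- tight and has room for one more.
    rcases (inn f A).eq_empty_or_nonempty with h0 | h0
    · rw [h0, Finset.card_empty] at hcard
      have := three_le_card h1.2
      omega
    · have hb1 := hb A h0
      have hnt := hA A
      have : (inn f A).card + 3 ≠ A.card + k := fun h => hnt ⟨h1.1, hqA, hsA, hleft, h0, h⟩
      omega
  · have hsub : inn (F t) A ⊆ inn f A := by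
      intro j hj
      by_cases hjr : j = r
      · subst hjr
        by_contra hcon
        exact hrin ⟨hj, hcon⟩
      · exact hother j hj hjr
    exact (Nat.add_le_add_right (Finset.card_le_card hsub) 3).trans (hb A (hne.mono hsub))

/-- A family with a single collinear triple can be made generic by moving one point. -/
theorem exists_perturb {k : ℕ} {f : ι → ℂ} (hf : Function.Injective f) (hu : UniqueCol f)
    (hb : Bdd k f) (hk : 1 ≤ k) (hg : ¬ Gen f) :
    ∃ (r : ι) (v : ℂ) (T : ℝ), 0 < T ∧ ∀ t ∈ Set.Ioc 0 T,
      Function.Injective (Function.update f r (f r + t • v)) ∧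
      Gen (Function.update f r (f r + t • v)) ∧ Bdd k (Function.update f r (f r + t • v)) := by
  unfold Gen at hg
  push Not at hg
  obtain ⟨i, j, l, hij, hil, hjl, h0⟩ := hg
  obtain ⟨q, r, s, hqr, hqs, hrs, m, hm0, hm1, hr⟩ := exists_middle hf hij hil hjl h0
  clear h0 hij hil hjl i j l
  -- Exchanging `q` and `s` reverses the direction of motion, and at least one direction is not
  -- blocked.
  obtain ⟨q, s, hqr, hqs, hrs, m, hm0, hm1, hr, hA⟩ : ∃ q s, q ≠ r ∧ q ≠ s ∧ r ≠ s ∧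
      ∃ m : ℝ, 0 < m ∧ m < 1 ∧ f r = (1 - m) • f q + m • f s ∧ ∀ A, ¬ Tight k f q r s A := by
    by_cases hA : ∀ A, ¬ Tight k f q r s A
    · exact ⟨q, s, hqr, hqs, hrs, m, hm0, hm1, hr, hA⟩
    · push Not at hA
      obtain ⟨A, hA⟩ := hA
      exact ⟨s, q, hrs.symm, hqs.symm, hqr.symm, 1 - m, by linarith, by linarith,
        by rw [hr]; module, fun A' hA' => not_tight_both hf hb hk hqs hm0 hm1 hr hA hA'⟩
  have hbd := eventually_bdd_update hf hu hb hk hqr hqs hrs hm0 hm1 hr hA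
  set ν := nrm (f q) (f s) with hν
  set F : ℝ → ι → ℂ := fun t => Function.update f r (f r + t • ν) with hF
  have hFr : ∀ t, F t r = f r + t • ν := fun t => Function.update_self _ _ _
  have hFj : ∀ t j, j ≠ r → F t j = f j := fun t j hj => Function.update_of_ne hj _ _
  have hF0 : F 0 = f := by simp only [hF, zero_smul, add_zero, Function.update_eq_self]
  have hFcont : ∀ j, Continuous fun t => F t j := by
    intro j
    by_cases hj : j = r
    · subst hj; simp only [hFr]; fun_prop
    · simp only [hFj _ j hj]; fun_prop
  have hr0 : cr (f q) (f s) (f r) = 0 := by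
    rw [cr_swap_right, hr, cr_comb_eq_zero, neg_zero]
  have hνpos : 0 < lin ν ν := lin_self_pos (nrm_ne_zero (hf.ne hqs))
  have hinj : ∀ᶠ t in 𝓝[>] (0 : ℝ), Function.Injective (F t) := by
    have : ∀ᶠ t in 𝓝 (0 : ℝ), ∀ i j, i ≠ j → F t i ≠ F t j := by
      rw [eventually_all]
      intro i
      rw [eventually_all]
      intro j
      by_cases hij : i = j
      · exact Eventually.of_forall fun t h => absurd hij h
      · have h1 : F 0 i ≠ F 0 j := by rw [hF0]; exact hf.ne hij
        filter_upwards [((hFcont i).continuousAt.ne_iff_eventually_ne (hFcont j).continuousAt).mp h1]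
          with t ht _
        exact ht
    filter_upwards [this.filter_mono nhdsWithin_le_nhds] with t ht i j hij
    by_contra hne
    exact ht i j hne hij
  have hgen : ∀ᶠ t in 𝓝[>] (0 : ℝ), Gen (F t) := by
    have : ∀ᶠ t in 𝓝 (0 : ℝ), ∀ i j l, cr (f i) (f j) (f l) ≠ 0 →
        cr (F t i) (F t j) (F t l) ≠ 0 := by
      rw [eventually_all]
      intro i
      rw [eventually_all]
      intro j
      rw [eventually_all]
      intro l
      by_cases hc : cr (f i) (f j) (f l) = 0
      · exact Eventually.of_forall fun t h => absurd hc h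
      · have hcont := continuous_cr (hFcont i) (hFcont j) (hFcont l)
        filter_upwards [hcont.continuousAt.eventually_ne (y := 0) (x := 0) (by
          simp only [hF0]; exact hc)] with t ht _
        exact ht
    filter_upwards [this.filter_mono nhdsWithin_le_nhds, self_mem_nhdsWithin]
      with t ht ht0 i j l hij hil hjl
    by_cases hc : cr (f i) (f j) (f l) = 0
    · refine cr_ne_zero_of_insert_eq hij hil hjl (hu _ _ _ _ _ _ hij hil hjl hqr hqs hrs hc
        (by rw [hr]; exact cr_comb_eq_zero _ _ _)) ?_
      rw [hFj t q hqr, hFj t s hrs.symm, cr_swap_right, hFr, cr_eq_lin, lin_add, lin_smul]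
      rw [cr_eq_lin] at hr0
      have : 0 < t * lin ν ν := mul_pos ht0 hνpos
      apply neg_ne_zero.mpr
      linarith
    · exact ht i j l hc
  obtain ⟨T, hT, hall⟩ := (nhdsGT_basis (0 : ℝ)).eventually_iff.mp (hinj.and (hgen.and hbd))
  refine ⟨r, ν, T / 2, by linarith, fun t ht => hall ⟨ht.1, by linarith [ht.2]⟩⟩

end Perturb

/-! ### Convex position and radial deformation to the circle. -/

section ConvexPosition

variable {ι : Type*}

/-- The members of `f` are in strictly convex position. -/
def ConvexPos (f : ι → ℂ) : Prop := ∀ j, ∃ w, ∀ i, i ≠ j → lin w (f i) < lin w (f j)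

lemma ConvexPos.injective {f : ι → ℂ} (h : ConvexPos f) : Function.Injective f := by
  intro i j hij
  by_contra hne
  obtain ⟨w, hw⟩ := h j
  have := hw i hne
  rw [hij] at this
  exact lt_irrefl _ this

/-- The middle point of a collinear triple cannot be strictly exposed. -/
lemma ConvexPos.gen {f : ι → ℂ} (h : ConvexPos f) : Gen f := by
  intro i j l hij hil hjl h0
  obtain ⟨q, r, s, hqr, hqs, hrs, m, hm0, hm1, hr⟩ := exists_middle h.injective hij hil hjl h0
  obtain ⟨w, hw⟩ := h r
  have h1 := hw q hqr
  have h2 := hw s hrs.symm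
  have h3 : lin w (f r) = (1 - m) * lin w (f q) + m * lin w (f s) := by
    rw [hr, lin_add, lin_smul, lin_smul]
  nlinarith

lemma ConvexPos.bdd [Fintype ι] [DecidableEq ι] {f : ι → ℂ} (h : ConvexPos f) (k : ℕ) :
    Bdd k f := by
  rintro A ⟨j, hj⟩
  rw [mem_inn] at hj
  obtain ⟨w, hw⟩ := h j
  have := lin_lt_of_mem_hull (fun i hi => hw i (fun h => hj.1 (h ▸ hi))) (interior_subset hj.2)
  exact absurd this (lt_irrefl _)

lemma lin_comb_left (x y : ℝ) (w v z : ℂ) :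
    lin (x • w + y • v) z = x * lin w z + y * lin v z := by
  simp only [lin, Complex.add_re, Complex.add_im, Complex.real_smul, Complex.mul_re,
    Complex.mul_im, Complex.ofReal_re, Complex.ofReal_im]
  ring

lemma lin_sub (w x y : ℂ) : lin w (x - y) = lin w x - lin w y := by
  simp only [lin, Complex.sub_re, Complex.sub_im]; ring

lemma lin_self_eq (z : ℂ) : lin z z = ‖z‖ ^ 2 := by
  rw [← Complex.normSq_eq_norm_sq, Complex.normSq_apply]; rfl

lemma lin_le_norm_mul (x y : ℂ) : lin x y ≤ ‖x‖ * ‖y‖ := by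
  have hx := lin_self_eq x
  have hy := lin_self_eq y
  simp only [lin] at *
  have hxy := mul_nonneg (norm_nonneg x) (norm_nonneg y)
  apply le_of_sq_le_sq _ hxy
  have : (‖x‖ * ‖y‖) ^ 2 = ‖x‖ ^ 2 * ‖y‖ ^ 2 := by ring
  rw [this, ← hx, ← hy]
  nlinarith [sq_nonneg (x.re * y.im - x.im * y.re)]

/-- This is the equality case of the Cauchy–Schwarz inequality. -/
lemma smul_eq_of_lin_eq {x y : ℂ} (h : lin x y = ‖x‖ * ‖y‖) : ‖x‖ • y = ‖y‖ • x := by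
  have hx := lin_self_eq x
  have hy := lin_self_eq y
  have h0 : lin (‖x‖ • y - ‖y‖ • x) (‖x‖ • y - ‖y‖ • x) = 0 := by
    have : lin (‖x‖ • y - ‖y‖ • x) (‖x‖ • y - ‖y‖ • x) =
        ‖x‖ ^ 2 * lin y y + ‖y‖ ^ 2 * lin x x - 2 * ‖x‖ * ‖y‖ * lin x y := by
      simp only [lin, Complex.sub_re, Complex.sub_im, Complex.real_smul, Complex.mul_re,
        Complex.mul_im, Complex.ofReal_re, Complex.ofReal_im]
      ring
    rw [this, hx, hy, h]; ring
  by_contra hne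
  exact (lin_self_pos (sub_ne_zero.mpr hne)).ne' h0

/-- A family in convex position can be translated such that all supporting functionals are
normalized to `1`. -/
lemma ConvexPos.exists_center [Fintype ι] {f : ι → ℂ} (h : ConvexPos f) :
    ∃ c, ∀ j, ∃ w, lin w (f j - c) = 1 ∧ ∀ i, i ≠ j → lin w (f i - c) < 1 := by
  classical
  rcases subsingleton_or_nontrivial ι with hs | hn
  · rcases isEmpty_or_nonempty ι with he | ⟨⟨j0⟩⟩
    · exact ⟨0, fun j => he.elim j⟩
    · refine ⟨f j0 - 1, fun j => ⟨1, ?_, fun i hi => absurd (Subsingleton.elim i j) hi⟩⟩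
      rw [Subsingleton.elim j j0]
      simp [lin]
  · set N : ℝ := ((Fintype.card ι : ℕ) : ℝ) with hN
    have hNpos : 0 < N := by
      rw [hN]; exact_mod_cast Fintype.card_pos
    -- With at least two points, each exposing functional is strictly smaller at the centroid than
    -- at its own vertex, so it can be rescaled.
    refine ⟨N⁻¹ • ∑ i, f i, fun j => ?_⟩
    obtain ⟨w, hw⟩ := h j
    set c := N⁻¹ • ∑ i, f i with hc
    have hsum : lin w c * N = ∑ i, lin w (f i) := by
      have : lin w (∑ i, f i) = ∑ i, lin w (f i) := map_sum (linMap w) _ _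
      rw [hc, lin_smul, this]
      field_simp
    have hlt : ∑ i, lin w (f i) < ∑ _i : ι, lin w (f j) := by
      obtain ⟨i0, hi0⟩ := exists_ne j
      refine Finset.sum_lt_sum (fun i _ => ?_) ⟨i0, Finset.mem_univ _, hw i0 hi0⟩
      by_cases hij : i = j
      · rw [hij]
      · exact (hw i hij).le
    rw [Finset.sum_const, Finset.card_univ, nsmul_eq_mul, ← hsum, mul_comm] at hlt
    have hpos : 0 < lin w (f j - c) := by
      rw [lin_sub]
      have := lt_of_mul_lt_mul_left hlt hNpos.le
      linarith
    have hscale : ∀ z, lin ((lin w (f j - c))⁻¹ • w) z = (lin w (f j - c))⁻¹ * lin w z := by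
      intro z
      have := lin_comb_left (lin w (f j - c))⁻¹ 0 w 0 z
      simpa using this
    refine ⟨(lin w (f j - c))⁻¹ • w, ?_, fun i hi => ?_⟩
    · rw [hscale, inv_mul_cancel₀ hpos.ne']
    · rw [hscale, inv_mul_lt_one₀ hpos, lin_sub, lin_sub]
      have := hw i hi
      linarith

/-- Radial deformation to the unit circle preserves convex position. -/
lemma convexPos_radial {g : ι → ℂ}
    (h : ∀ j, ∃ w, lin w (g j) = 1 ∧ ∀ i, i ≠ j → lin w (g i) < 1) {t : ℝ} (h0 : 0 ≤ t)
    (h1 : t ≤ 1) : ConvexPos fun i => ((1 - t) + t * ‖g i‖)⁻¹ • g i := by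
  have hr : ∀ i, 0 < ‖g i‖ := by
    intro i
    obtain ⟨w, hw, _⟩ := h i
    rw [norm_pos_iff]
    intro h0
    rw [h0] at hw
    simp [lin] at hw
  have hD : ∀ i, 0 < (1 - t) + t * ‖g i‖ := by
    intro i
    rcases h1.eq_or_lt with rfl | h1
    · have := hr i; linarith
    · have := mul_nonneg h0 (hr i).le; linarith
  intro j
  obtain ⟨w, hw1, hw⟩ := h j
  -- Interpolate between the old functional and the unit radial one. Before rescaling, the value at
  -- `g j` equals the radial divisor, and at other points it is below theirs.
  refine ⟨(1 - t) • w + (t * ‖g j‖⁻¹) • g j, fun i hij => ?_⟩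
  rw [lin_smul, lin_smul, lin_comb_left, lin_comb_left, hw1, lin_self_eq]
  have e1 : ((1 - t) + t * ‖g j‖)⁻¹ * ((1 - t) * 1 + t * ‖g j‖⁻¹ * ‖g j‖ ^ 2) = 1 := by
    have := (hr j).ne'
    have := (hD j).ne'
    field_simp
  rw [e1, inv_mul_lt_one₀ (hD i)]
  have hi := hw i hij
  have hle : ‖g j‖⁻¹ * lin (g j) (g i) ≤ ‖g i‖ := by
    rw [inv_mul_le_iff₀ (hr j)]
    exact lin_le_norm_mul _ _
  rcases h1.eq_or_lt with rfl | h1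
  -- At `t = 1` strictness needs distinct directions: parallel `g i` and `g j` would violate one of
  -- the two normalized functionals.
  · have hne : lin (g j) (g i) ≠ ‖g j‖ * ‖g i‖ := by
      intro heq
      have hs := smul_eq_of_lin_eq heq
      obtain ⟨v, hv1, hv⟩ := h i
      have hj := hv j (Ne.symm hij)
      have a1 := congrArg (lin w) hs
      have a2 := congrArg (lin v) hs
      rw [lin_smul, lin_smul, hw1] at a1
      rw [lin_smul, lin_smul, hv1] at a2
      have := hr i
      have := hr j
      nlinarith
    have hlt : ‖g j‖⁻¹ * lin (g j) (g i) < ‖g i‖ := by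
      rw [inv_mul_lt_iff₀ (hr j)]
      exact lt_of_le_of_ne (lin_le_norm_mul _ _) hne
    linarith
  · have a1 := mul_lt_mul_of_pos_left hi (sub_pos.mpr h1)
    have a2 := mul_le_mul_of_nonneg_left hle h0
    linarith

/-- Distinct points of the unit circle are in convex position. -/
lemma convexPos_circle {g : ι → ℂ} (hg : Function.Injective g) (h : ∀ i, ‖g i‖ = 1) :
    ConvexPos g := by
  intro j
  refine ⟨g j, fun i hij => ?_⟩
  rw [lin_self_eq, h j]
  refine lt_of_le_of_ne (by simpa [h] using lin_le_norm_mul (g j) (g i)) fun heq => ?_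
  have := smul_eq_of_lin_eq (x := g j) (y := g i) (by rw [heq, h, h]; norm_num)
  rw [h, h, one_smul, one_smul] at this
  exact hij (hg this)

end ConvexPosition

/-! ### Connected components of the configuration space and the conclusion. -/

section Connected

/-- The configurations with the weak Property `Δ_k`. -/
def weakSet (n k : ℕ) : Set (UConf n) := {c | WeakDelta k c.points}

/-- The unordered configuration of an injective family. -/
def conf {n : ℕ} (f : Fin n → ℂ) (hf : Function.Injective f) : UConf n :=
  Quotient.mk (permSetoid n) ⟨f, hf⟩

lemma conf_mem_weakSet {n k : ℕ} {f : Fin n → ℂ} (hf : Function.Injective f) :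
    conf f hf ∈ weakSet n k ↔ UniqueCol f ∧ Bdd k f := by
  rw [← weakDelta_iff hf]
  change WeakDelta k (conf f hf).points ↔ _
  have : (conf f hf).points = @Finset.image _ _ (Classical.decEq ℂ) f Finset.univ := by
    ext z
    simp [conf, UConf.points]
  rw [this]

/-- `f` and `g` give configurations in the same component of `weakSet n k`. -/
def Linked (n k : ℕ) (f g : Fin n → ℂ) : Prop :=
  ∃ (hf : Function.Injective f) (hg : Function.Injective g),
    conf g hg ∈ connectedComponentIn (weakSet n k) (conf f hf)

lemma Linked.trans {n k : ℕ} {f g h : Fin n → ℂ} (h1 : Linked n k f g) (h2 : Linked n k g h) :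
    Linked n k f h := by
  obtain ⟨hf, hg, h1⟩ := h1
  obtain ⟨_, hh, h2⟩ := h2
  refine ⟨hf, hh, ?_⟩
  rwa [connectedComponentIn_eq h1]

/-- Families on a preconnected set of parameters are linked. -/
lemma linked_of_isPreconnected {n k : ℕ} {X : Type*} [TopologicalSpace X] {s : Set X}
    (hs : IsPreconnected s) {F : X → Fin n → ℂ} (hF : ContinuousOn F s)
    (hgood : ∀ x ∈ s, Function.Injective (F x) ∧ UniqueCol (F x) ∧ Bdd k (F x)) {x y : X}
    (hx : x ∈ s) (hy : y ∈ s) : Linked n k (F x) (F y) := by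
  refine ⟨(hgood x hx).1, (hgood y hy).1, ?_⟩
  let γ : s → UConf n := fun x => conf (F x) (hgood x x.2).1
  have hγ : Continuous γ := by
    have h1 : Continuous fun x : s => (⟨F x, (hgood x x.2).1⟩ : OrdConf n) :=
      Continuous.subtype_mk (continuousOn_iff_continuous_domRestrict.mp hF) _
    exact continuous_quotient_mk'.comp h1
  have : PreconnectedSpace s := isPreconnected_iff_preconnectedSpace.mp hs
  have hpre : IsPreconnected (Set.range γ) := isPreconnected_range hγ
  have hsub : Set.range γ ⊆ weakSet n k := by
    rintro _ ⟨x, rfl⟩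
    exact (conf_mem_weakSet _).mpr (hgood x x.2).2
  exact hpre.subset_connectedComponentIn (x := γ ⟨x, hx⟩) ⟨⟨x, hx⟩, rfl⟩ hsub ⟨⟨y, hy⟩, rfl⟩

lemma ConvexPos.good {n : ℕ} {f : Fin n → ℂ} (h : ConvexPos f) (k : ℕ) :
    Function.Injective f ∧ UniqueCol f ∧ Bdd k f :=
  ⟨h.injective, h.gen.uniqueCol, h.bdd k⟩

lemma continuous_update_line {n : ℕ} (f : Fin n → ℂ) (p : Fin n) (v : ℂ) :
    Continuous fun t : ℝ => Function.update f p (f p + t • v) :=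
  continuous_const.update p (by fun_prop)

/-- Induction on the size of the core: each move lowers it, and with empty core every point is
exposed. -/
lemma exists_linked_convexPos {n k : ℕ} (hk : 1 ≤ k) (hk2 : k ≤ 2) {f : Fin n → ℂ}
    (hf : Function.Injective f) (hg : Gen f) (hb : Bdd k f) :
    ∃ g, ConvexPos g ∧ Linked n k f g := by
  induction hN : (core f).card using Nat.strong_induction_on generalizing f with
  | _ N ih =>
    rcases (core f).eq_empty_or_nonempty with h0 | hne
    · refine ⟨f, fun j => exists_lin_lt_of_notMem_core hf hg (by simp [h0]), hf, hf, ?_⟩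
      exact mem_connectedComponentIn ((conf_mem_weakSet hf).mpr ⟨hg.uniqueCol, hb⟩)
    · obtain ⟨p, v, T, hT, hpath, hgen, hcard⟩ := exists_move hf hg hb hk hk2 hne
      have hl := linked_of_isPreconnected (n := n) (k := k) isPreconnected_Icc
        (continuous_update_line f p v).continuousOn hpath
        (Set.left_mem_Icc.mpr hT.le) (Set.right_mem_Icc.mpr hT.le)
      simp only [zero_smul, add_zero, Function.update_eq_self] at hl
      obtain ⟨hi, _, hb'⟩ := hpath T (Set.right_mem_Icc.mpr hT.le)
      obtain ⟨g, hg1, hg2⟩ := ih _ (hN ▸ hcard) hi hgen hb' rfl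
      exact ⟨g, hg1, hl.trans hg2⟩

lemma ConvexPos.exists_linked_circle {n : ℕ} (k : ℕ) {f : Fin n → ℂ} (h : ConvexPos f) :
    ∃ g : Fin n → ℂ, (∀ i, ‖g i‖ = 1) ∧ Linked n k f g := by
  obtain ⟨c, hc⟩ := h.exists_center
  have h1 : Linked n k f (fun i => f i - c) := by
    have := linked_of_isPreconnected (n := n) (k := k) (isPreconnected_Icc (a := (0 : ℝ)) (b := 1))
      (F := fun t i => f i - t • c) (by fun_prop) (fun t _ => ConvexPos.good (fun j => by
        obtain ⟨w, hw⟩ := h j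
        refine ⟨w, fun i hi => ?_⟩
        rw [lin_sub, lin_sub]
        have := hw i hi
        linarith) k) (Set.left_mem_Icc.mpr zero_le_one) (Set.right_mem_Icc.mpr zero_le_one)
    simpa using this
  have hne : ∀ i, ‖f i - c‖ ≠ 0 := by
    intro i
    obtain ⟨w, hw, _⟩ := hc i
    rw [norm_ne_zero_iff]
    intro h0
    rw [h0] at hw
    simp [lin] at hw
  refine ⟨fun i => ‖f i - c‖⁻¹ • (f i - c), fun i => ?_, h1.trans ?_⟩
  · rw [norm_smul, norm_inv, norm_norm, inv_mul_cancel₀ (hne i)]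
  · have := linked_of_isPreconnected (n := n) (k := k) (isPreconnected_Icc (a := (0 : ℝ)) (b := 1))
      (F := fun t i => ((1 - t) + t * ‖f i - c‖)⁻¹ • (f i - c)) (by
        rw [continuousOn_pi]
        intro i
        refine ContinuousOn.smul (ContinuousOn.inv₀
          (f := fun t : ℝ => (1 - t) + t * ‖f i - c‖) (by fun_prop) (fun t ht => ?_))
          continuousOn_const
        have hp : 0 < ‖f i - c‖ := lt_of_le_of_ne (norm_nonneg _) (hne i).symm
        rcases ht.2.eq_or_lt with h | h
        · rw [h]; linarith
        · have := mul_nonneg ht.1 hp.le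
          linarith)
      (fun t ht => (convexPos_radial hc ht.1 ht.2).good k)
      (Set.left_mem_Icc.mpr zero_le_one) (Set.right_mem_Icc.mpr zero_le_one)
    simpa using this

/-- Increasing angles within one turn. -/
def angles (n : ℕ) : Set (Fin n → ℝ) :=
  {θ | (∀ i j, i < j → θ i < θ j) ∧ ∀ i j, θ i - θ j < 2 * Real.pi}

lemma convex_angles (n : ℕ) : Convex ℝ (angles n) := by
  rintro θ ⟨h1, h2⟩ φ ⟨g1, g2⟩ a b ha hb hab
  refine ⟨fun i j hij => ?_, fun i j => ?_⟩
  · have e1 := h1 i j hij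
    have e2 := g1 i j hij
    simp only [Pi.add_apply, Pi.smul_apply, smul_eq_mul]
    rcases ha.eq_or_lt with rfl | ha
    · simp only [zero_add] at hab
      subst hab; linarith
    · nlinarith
  · have e1 := h2 i j
    have e2 := g2 i j
    simp only [Pi.add_apply, Pi.smul_apply, smul_eq_mul]
    obtain rfl : b = 1 - a := by linarith
    rcases ha.eq_or_lt with rfl | ha
    · linarith
    · nlinarith

/-- The points of the unit circle with given angles. -/
noncomputable def circlePoints {n : ℕ} (θ : Fin n → ℝ) : Fin n → ℂ :=
  fun i => Complex.exp (θ i * Complex.I)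

lemma norm_circlePoints {n : ℕ} (θ : Fin n → ℝ) (i : Fin n) : ‖circlePoints θ i‖ = 1 :=
  Complex.norm_exp_ofReal_mul_I _

lemma circlePoints_injective {n : ℕ} {θ : Fin n → ℝ} (h : θ ∈ angles n) :
    Function.Injective (circlePoints θ) := by
  intro i j hij
  rw [circlePoints, circlePoints, Complex.exp_eq_exp_iff_exists_int] at hij
  obtain ⟨m, hm⟩ := hij
  have hre : θ i = θ j + m * (2 * Real.pi) := by
    have := congrArg Complex.im hm
    simpa using this
  have h1 := h.2 i j
  have h2 := h.2 j i
  have hpi := Real.pi_pos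
  have m0 : m = 0 := by
    have u1 : (m : ℝ) < 1 := by nlinarith
    have u2 : (-1 : ℝ) < m := by nlinarith
    have u1' : m < 1 := by exact_mod_cast u1
    have u2' : -1 < m := by exact_mod_cast u2
    omega
  rw [m0] at hre
  rcases lt_trichotomy i j with hlt | heq | hgt
  · have := h.1 i j hlt; simp at hre; linarith
  · exact heq
  · have := h.1 j i hgt; simp at hre; linarith

/-- The admissible angles form a convex, hence preconnected, set, and distinct points of the circle
are in convex position. -/
lemma linked_circlePoints {n k : ℕ} {θ φ : Fin n → ℝ} (hθ : θ ∈ angles n) (hφ : φ ∈ angles n) :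
    Linked n k (circlePoints θ) (circlePoints φ) :=
  linked_of_isPreconnected (convex_angles n).isPreconnected (F := circlePoints)
    (by unfold circlePoints; fun_prop) (fun θ h => (convexPos_circle (circlePoints_injective h)
      (norm_circlePoints θ)).good k) hθ hφ

lemma conf_comp_perm {n : ℕ} {f : Fin n → ℂ} (hf : Function.Injective f)
    (σ : Equiv.Perm (Fin n)) : conf (f ∘ σ) (hf.comp σ.injective) = conf f hf :=
  Quotient.sound ⟨σ⁻¹, by ext i; simp⟩

/-- Every family of distinct points of the unit circle is a permutation of one with increasing
angles. -/
lemma exists_perm_circlePoints {n : ℕ} {g : Fin n → ℂ} (hg : Function.Injective g)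
    (h : ∀ i, ‖g i‖ = 1) : ∃ (σ : Equiv.Perm (Fin n)), ∃ θ ∈ angles n,
      g ∘ σ = circlePoints θ := by
  have hexp : ∀ i, Complex.exp (Complex.arg (g i) * Complex.I) = g i := by
    intro i
    have := Complex.norm_mul_exp_arg_mul_I (g i)
    rwa [h i, Complex.ofReal_one, one_mul] at this
  set a : Fin n → ℝ := fun i => Complex.arg (g i) with ha
  have hinj : Function.Injective a := by
    intro i j hij
    apply hg
    rw [← hexp i, ← hexp j]
    simp only [ha] at hij
    rw [hij]
  refine ⟨Tuple.sort a, a ∘ Tuple.sort a, ⟨?_, fun i j => ?_⟩, ?_⟩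
  · have := (Tuple.monotone_sort a).strictMono_of_injective (hinj.comp (Tuple.sort a).injective)
    exact fun i j hij => this hij
  · have h1 := Complex.arg_le_pi (g (Tuple.sort a i))
    have h2 := Complex.neg_pi_lt_arg (g (Tuple.sort a j))
    simp only [Function.comp, ha]
    linarith
  · ext i
    simp only [Function.comp, circlePoints, ha]
    exact (hexp _).symm

lemma exists_angles (n : ℕ) : ∃ θ, θ ∈ angles n := by
  refine ⟨fun i => (i : ℝ) / n, fun i j hij => ?_, fun i j => ?_⟩
  · have hn : (0 : ℝ) < n := by
      have := i.pos
      exact_mod_cast this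
    have : (i : ℝ) < j := by exact_mod_cast hij
    exact div_lt_div_of_pos_right this hn
  · have hn : (0 : ℝ) < n := by
      have := i.pos
      exact_mod_cast this
    have h1 : (i : ℝ) / n < 1 := by
      rw [div_lt_one hn]; exact_mod_cast i.2
    have h2 : (0 : ℝ) ≤ (j : ℝ) / n := by positivity
    have := Real.pi_gt_three
    linarith

theorem isConnected_weakSet (n k : ℕ) (hk : 1 ≤ k) (hk2 : k ≤ 2) : IsConnected (weakSet n k) := by
  obtain ⟨θ, hθ⟩ := exists_angles n
  have hθinj := circlePoints_injective hθ
  -- One fixed configuration on the circle lies in the component of every configuration, so there is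
  -- only one component.
  have hall : ∀ c ∈ weakSet n k, conf _ hθinj ∈ connectedComponentIn (weakSet n k) c := by
    intro c hc
    induction c using Quotient.inductionOn with
    | h x =>
      obtain ⟨f, hf⟩ := x
      change conf _ hθinj ∈ connectedComponentIn (weakSet n k) (conf f hf)
      obtain ⟨hu, hb⟩ := (conf_mem_weakSet hf).mp hc
      obtain ⟨f', hf', hg', hb', hl⟩ : ∃ f', Function.Injective f' ∧ Gen f' ∧ Bdd k f' ∧
          Linked n k f f' := by
        by_cases hg : Gen f
        · exact ⟨f, hf, hg, hb, hf, hf, mem_connectedComponentIn hc⟩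
        · obtain ⟨r, v, T, hT, hpath⟩ := exists_perturb hf hu hb hk hg
          obtain ⟨e1, e2, e3⟩ := hpath T ⟨hT, le_rfl⟩
          refine ⟨_, e1, e2, e3, ?_⟩
          have hl := linked_of_isPreconnected (n := n) (k := k) isPreconnected_Icc
            (continuous_update_line f r v).continuousOn (fun t ht => by
              rcases ht.1.eq_or_lt with h | h
              · rw [← h]
                simp only [zero_smul, add_zero, Function.update_eq_self]
                exact ⟨hf, hu, hb⟩
              · obtain ⟨d1, d2, d3⟩ := hpath t ⟨h, ht.2⟩
                exact ⟨d1, d2.uniqueCol, d3⟩)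
            (Set.left_mem_Icc.mpr hT.le) (Set.right_mem_Icc.mpr hT.le)
          simpa only [zero_smul, add_zero, Function.update_eq_self] using hl
      obtain ⟨g, hgc, hl2⟩ := exists_linked_convexPos hk hk2 hf' hg' hb'
      obtain ⟨g', hg1, hl3⟩ := hgc.exists_linked_circle k
      obtain ⟨hf1, hg'inj, hmem⟩ := (hl.trans hl2).trans hl3
      obtain ⟨σ, φ, hφ, hσ⟩ := exists_perm_circlePoints hg'inj hg1
      obtain ⟨hφinj, _, hmem2⟩ := linked_circlePoints (k := k) hφ hθ
      -- Sorting by angle only relabels the points, so the unordered configuration does not change.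
      have heq : conf (circlePoints φ) hφinj = conf g' hg'inj := by
        rw [← conf_comp_perm hg'inj σ]
        congr 1
        exact hσ.symm
      rw [heq] at hmem2
      rwa [connectedComponentIn_eq hmem]
  have hbase : conf _ hθinj ∈ weakSet n k := (conf_mem_weakSet hθinj).mpr
    ((convexPos_circle hθinj (norm_circlePoints θ)).good k).2
  refine ⟨⟨_, hbase⟩, ?_⟩
  have hEq : weakSet n k = connectedComponentIn (weakSet n k) (conf _ hθinj) := by
    apply subset_antisymm _ (connectedComponentIn_subset _ _)
    intro c hc
    rw [← connectedComponentIn_eq (hall c hc)]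
    exact mem_connectedComponentIn hc
  rw [hEq]
  exact isPreconnected_connectedComponentIn

end Connected

end PlanarConf

theorem corollary2p7 (n k : ℕ) (hk : k = 1 ∨ k = 2) :
    IsConnected {c : UConf n | WeakDelta k c.points} := by
  exact PlanarConf.isConnected_weakSet n k (by omega) (by omega)
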